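/- Let $\Bbbk$ be a field. All semigroups and ground sets are finite. Write $L=\{0,+,-\}$; for a set $E$, $L^E$ is a monoid under $(xy)_e=x_e$ if $x_e\neq 0$ and $(xy)_e=y_e$ otherwise, with identity $0$. Put $Z(x)=\{e\mid x_e=0\}$. An oriented matroid $\mathcal L\subseteq L^E$ (given by its covectors) is a submonoid closed under $x\mapsto -x$ and satisfying strong elimination: if $x,y\in\mathcal L$ and $x_e=-y_e\ne 0$, there is $z\in\mathcal L$ with $z_e=0$ and $z_f=(xy)_f$ for all $f$ not separating $x$ and $y$ (that is, not satisfying $x_f=-y_f\neq 0$). A COM is a set $\mathcal L\subseteq L^E$ satisfying strong elimination and closed under $(x,y)\mapsto x(-y)$; it is a subsemigroup. A left regular band is a semigroup $B$ with $x^2=x$ and $xyx=xy$, ordered by $x\le y$ iff $yx=x$. Let $\Lambda(B)=\{Bb\mid b\in B\}$, and for $X\in\Lambda(B)$ let $B_{\ge X}=\{b\mid Bb\supseteq X\}$; $B$ is connected if the order complex of each $B_{\geq X}$ is connected. Let $\Bbbk_X$ be the one-dimensional (left and right) $\Bbbk B$-module on which $b$ acts as $1$ if $b\in B_{\ge X}$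 and as $0$ otherwise. The cocircuits of an oriented matroid $\mathcal L$ are its maximal elements different from $0$. A single-element extension of $(E,\mathcal L)$ is an oriented matroid $\mathcal L_\sigma$ on $E\cup\{p\}$, $p\notin E$, in which $p$ is not a coloop and whose image under the projection $\pi\colon L^{E\cup\{p\}}\to L^E$ is $\mathcal L$; the corresponding map $\sigma$ from the cocircuits of $\mathcal L$ to $L$ is the one for which $(y,\sigma(y))$ is a cocircuit of $\mathcal L_\sigma$ for every cocircuit $y$ of $\mathcal L$. The extension is generic if $\sigma$ is nowhere $0$. The visual hemisphere is $R(\sigma)=\pi(\{x\in\mathcal L_\sigma\mid x_p=+\})$, a right ideal of $\mathcal L$. (1) Let $\mathcal L_\sigma$ be a generic single-element extension of an oriented matroid $\mathcal L$, and let $\widehat 1=\mathcal L$ be the maximum of $\Lambda(\mathcal L)$. Then the natural homomorphism $\Bbbk\mathcal L/\Bbbk R(\sigma)\to\Bbbk_{\widehat 1}$ (sending the identity to $1$ and the other elements of $\mathcal L$ to $0$) is the right projective cover of $\Bbbk_{\widehat 1}$. (2) Let $B$ be a connected left regular band. Then $\Bbbk B$ is unital and the $\Bbbk_X$, $X\in\Lambda(B)$,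 are, up to isomorphism and without repetition, the simple left $\Bbbk B$-modules. Let $e\in B$, $X=Be$, let $\tau\colon eB\to\mathcal L$ be an isomorphism onto an oriented matroid and let $\mathcal L_\sigma$ be a generic single-element extension of $\mathcal L$. Then the natural homomorphism $\Bbbk eB/\Bbbk\tau^{-1}(R(\sigma))\to\Bbbk_X$, $e\mapsto 1$, $b\mapsto 0$ for $b\in eB\setminus\{e\}$, is the right projective cover of $\Bbbk_X$. The left $\Bbbk B$-module $I_X$ of all maps $f\colon eB\to\Bbbk$ vanishing on $\tau^{-1}(R(\sigma))$, with $(bf)(a)=f(ab)$, is the injective envelope of $\Bbbk_X$, where $\Bbbk_X$ is embedded as the multiples of the indicator function of $e$; its socle is simple, is isomorphic to $\Bbbk_X$, and consists of the maps vanishing on $eB\setminus\{e\}$. (3) Let $\mathcal L\subseteq L^E$ be a COM. Then $\mathcal L$ is a connected left regular band, and for each $x\in\mathcal L$ the map $y\mapsto y|_{Z(x)}$ is an isomorphism of $x\mathcal L$ onto an oriented matroid on $Z(x)$, which has a generic single-element extension. Hence (2) gives explicit injective envelopes of all simple left $\Bbbk\mathcal L$-modules. If moreover $\mathcal L$ is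 a right ideal of $L^E$ (as is the face semigroup of a finite CAT(0) cube complex, $E$ being its set of oriented hyperplanes), then for every $x\in\mathcal L$ one may take for $\tau^{-1}(R(\sigma))$ in (2) the set of all $y\in x\mathcal L$ with $y_e=+$ for some $e\in Z(x)$. (4) The following are COMs: the set of sign vectors $(\mathrm{sgn}(f_i(v)-c_i))_{i\in E}$, $v\in\mathbb R^d$, of an affine hyperplane arrangement $\{f_i=c_i\}_{i \in E}$ in $\mathbb R^d$ (an oriented matroid if all $c_i=0$); and $\{x\in\mathcal L\mid x_e=+\text{ for all }e\in A\}$ for an oriented matroid $\mathcal L$ on $E$ and $A\subseteq E$. -/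

import Mathlib

open MulOpposite

universe u v w

/-! ## Left regular bands and their support semilattices -/

/-- A left regular band: a semigroup satisfying `x² = x` and `xyx = xy`. -/
class IsLeftRegularBand (B : Type*) [Semigroup B] : Prop where
  idem : ∀ x : B, x * x = x
  regular : ∀ x y : B, x * y * x = x * y

/-- The support semilattice `Λ(B)`: the principal left ideals `Bb`, as subsets of `B`. -/
def Support (B : Type*) [Mul B] : Type _ := {X : Set B // ∃ b : B, X = Set.range (fun c => c * b)}

/-- The support map `b ↦ Bb`. -/
def supp {B : Type*} [Mul B] (b : B) : Support B := ⟨Set.range (fun c => c * b), b, rfl⟩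

/-- The maximum `B` of `Λ(B)` for a monoid `B`. -/
def topSupport (B : Type*) [Monoid B] : Support B :=
  ⟨Set.univ, 1, by ext c; simp⟩

/-- The contraction `B_{≥ X}`: the elements `a` with `X ⊆ Ba`. -/
def contraction {B : Type*} [Mul B] (X : Support B) : Set B := {a | X.1 ⊆ (supp a).1}

/-- The `1`-skeleton of the order complex of a subset of a left regular band, for the order
`x ≤ y ↔ yx = x`: two distinct elements are joined when they are comparable. -/
def comparabilityGraph {B : Type*} [Mul B] (S : Set B) : SimpleGraph S where
  Adj x y := x ≠ y ∧ ((y : B) * x = x ∨ (x : B) * y = y)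
  symm := ⟨fun _ _ h => ⟨h.1.symm, h.2.symm⟩⟩
  loopless := ⟨fun _ h => h.1 rfl⟩

/-- `B` is connected if the order complexes of all the contractions `B_{≥ X}` are connected. -/
def IsConnectedBand (B : Type*) [Mul B] : Prop :=
  ∀ X : Support B, (comparabilityGraph (contraction X)).Connected

/-- A right ideal (possibly empty) of a semigroup. -/
structure RightIdeal (B : Type*) [Mul B] where
  carrier : Set B
  mul_mem : ∀ {a : B} (b : B), a ∈ carrier → a * b ∈ carrier

/-- The principal right ideal `eB`. -/
def principalRight {B : Type*} [Semigroup B] (e : B) : RightIdeal B where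
  carrier := {a | ∃ b, a = e * b}
  mul_mem := by rintro _ b ⟨c, rfl⟩; exact ⟨c * b, mul_assoc _ _ _⟩

/-- `eB` as a subsemigroup of `B`. -/
def corner {B : Type*} [Semigroup B] (e : B) : Subsemigroup B where
  carrier := {a | ∃ b, a = e * b}
  mul_mem' := by rintro _ d ⟨c, rfl⟩ _; exact ⟨c * d, mul_assoc _ _ _⟩

/-- `e`, the identity of `eB`, as an element of `eB`. -/
def cornerOne {B : Type*} [Semigroup B] [IsLeftRegularBand B] (e : B) : corner e :=
  ⟨e, e, (IsLeftRegularBand.idem e).symm⟩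

/-! ## The algebra of a finite left regular band, which is unital under a hypothesis -/

/-- The semigroup algebra `kB` has a (two-sided) identity element. -/
class HasUnit (k B : Type*) [Field k] [Semigroup B] : Prop where
  exists_unit : ∃ η : MonoidAlgebra k B, ∀ a, η * a = a ∧ a * η = a

/-- The semigroup algebra `kB`. -/
def BandAlg (k B : Type*) [Field k] [Semigroup B] : Type _ := MonoidAlgebra k B

section BandAlg

variable (k : Type*) {B : Type*} [Field k] [Semigroup B]

noncomputable instance : NonUnitalRing (BandAlg k B) :=
  inferInstanceAs (NonUnitalRing (MonoidAlgebra k B))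

noncomputable instance : Module k (BandAlg k B) :=
  inferInstanceAs (Module k (MonoidAlgebra k B))

/-- When `kB` has an identity element, it is a ring with that element as `1`. -/
noncomputable instance [h : HasUnit k B] : Ring (BandAlg k B) :=
  { (inferInstance : NonUnitalRing (BandAlg k B)) with
    one := h.exists_unit.choose
    one_mul := fun a => (h.exists_unit.choose_spec a).1
    mul_one := fun a => (h.exists_unit.choose_spec a).2 }

instance {M : Type*} [Monoid M] : HasUnit k M :=
  ⟨1, fun a => ⟨one_mul a, mul_one a⟩⟩

/-- The basis element of `kB` given by `b ∈ B`. -/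
noncomputable def basisElt (b : B) : BandAlg k B := MonoidAlgebra.single b 1

theorem basisElt_mul (a b : B) : basisElt k a * basisElt k b = basisElt k (a * b) := by
  unfold basisElt BandAlg
  exact (MonoidAlgebra.single_mul_single ..).trans (by rw [one_mul])

theorem span_basisElt (x : BandAlg k B) : x ∈ Submodule.span k (Set.range (basisElt k (B := B))) := by
  refine MonoidAlgebra.induction_linear (motive := fun x : MonoidAlgebra k B =>
    (show BandAlg k B from x) ∈ Submodule.span k (Set.range (basisElt k (B := B)))) x ?_ ?_ ?_
  · exact Submodule.zero_mem _
  · intro a b ha hb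
    exact Submodule.add_mem _ ha hb
  · intro b c
    have : (MonoidAlgebra.single b c : MonoidAlgebra k B) = c • MonoidAlgebra.single b 1 := by simp
    rw [this]
    exact Submodule.smul_mem _ _ (Submodule.subset_span ⟨b, rfl⟩)

theorem bandAlg_smul_mul (c : k) (x y : BandAlg k B) : (c • x) * y = c • (x * y) :=
  smul_mul_assoc (α := k) (β := MonoidAlgebra k B) c x y

theorem bandAlg_mul_smul (c : k) (x y : BandAlg k B) : x * (c • y) = c • (x * y) :=
  mul_smul_comm (α := k) (β := MonoidAlgebra k B) c x y

/-- For a right ideal `S` of `B`, the linear span `kS` of `S`, a right ideal of `kB`. -/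
noncomputable def linSpan [HasUnit k B] (S : RightIdeal B) :
    Submodule (BandAlg k B)ᵐᵒᵖ (BandAlg k B) where
  carrier := {x | x ∈ Submodule.span k (basisElt k '' S.carrier)}
  zero_mem' := Submodule.zero_mem (Submodule.span k (basisElt k '' S.carrier))
  add_mem' := fun ha hb => Submodule.add_mem (Submodule.span k (basisElt k '' S.carrier)) ha hb
  smul_mem' := by
    intro c x hx
    change x * c.unop ∈ Submodule.span k (basisElt k '' S.carrier)
    have hx' : x ∈ Submodule.span k (basisElt k '' S.carrier) := hx
    generalize c.unop = c
    have hc := span_basisElt k c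
    induction hx' using Submodule.span_induction with
    | zero => rw [zero_mul]; exact Submodule.zero_mem _
    | add a b _ _ ha hb =>
      rw [add_mul]; exact Submodule.add_mem _ (ha (by assumption)) (hb (by assumption))
    | smul t a _ ha =>
      rw [bandAlg_smul_mul]; exact Submodule.smul_mem _ _ (ha (by assumption))
    | mem a ha =>
      obtain ⟨s, hs, rfl⟩ := ha
      induction hc using Submodule.span_induction with
      | zero => rw [mul_zero]; exact Submodule.zero_mem _
      | add a b _ _ ha hb => rw [mul_add]; exact Submodule.add_mem _ ha hb
      | smul t a _ ha => rw [bandAlg_mul_smul]; exact Submodule.smul_mem _ _ ha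
      | mem b hb =>
        obtain ⟨b, rfl⟩ := hb
        rw [basisElt_mul]
        exact Submodule.subset_span ⟨_, S.mul_mem b hs, rfl⟩

theorem liftMagma_basisElt {A : Type*} [Ring A] [Algebra k A] (f : B →ₙ* A) (b : B) :
    MonoidAlgebra.liftMagma k f (basisElt k b) = f b := by
  simp [basisElt, MonoidAlgebra.liftMagma_apply_apply]

theorem basisElt_mem [HasUnit k B] {S : RightIdeal B} {b : B} (hb : b ∈ S.carrier) :
    basisElt k b ∈ linSpan k S :=
  Submodule.subset_span (R := k) (s := basisElt k '' S.carrier) ⟨b, hb, rfl⟩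

/-- A multiplicative map from `B` to a `k`-algebra that takes the value `1` extends linearly to a
ring homomorphism from `kB`. -/
noncomputable def extendHom [HasUnit k B] {A : Type*} [Ring A] [Algebra k A] (f : B →ₙ* A)
    (hf : ∃ x, f x = 1) : BandAlg k B →+* A where
  toFun x := MonoidAlgebra.liftMagma k f x
  map_one' := by
    obtain ⟨x, hx⟩ := hf
    have h2 := liftMagma_basisElt k f x
    have h1 := map_mul (MonoidAlgebra.liftMagma k f) (1 : BandAlg k B) (basisElt k x)
    have h0 : ((1 : BandAlg k B) * basisElt k x) = basisElt k x := one_mul _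
    exact (mul_one _).symm.trans ((congrArg (_ * ·) (h2.trans hx).symm).trans
      (h1.symm.trans ((congrArg (MonoidAlgebra.liftMagma k f) h0).trans (h2.trans hx))))
  map_zero' := map_zero (MonoidAlgebra.liftMagma k f)
  map_add' := map_add (MonoidAlgebra.liftMagma k f)
  map_mul' := map_mul (MonoidAlgebra.liftMagma k f)

end BandAlg

/-! ## The simple modules `k_X` -/

section Simple

variable (k : Type*) {B : Type*} [Field k] [Semigroup B] [IsLeftRegularBand B]

theorem mem_contraction_mul (X : Support B) (a b : B) :
    a * b ∈ contraction X ↔ a ∈ contraction X ∧ b ∈ contraction X := by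
  obtain ⟨_, x, rfl⟩ := X
  have key : ∀ c : B, c ∈ contraction (supp x) ↔ x * c = x := by
    intro c
    constructor
    · intro h
      obtain ⟨d, hd⟩ := h ⟨x, IsLeftRegularBand.idem x⟩
      simp only at hd
      rw [← hd, mul_assoc, IsLeftRegularBand.idem]
    · rintro h _ ⟨d, rfl⟩
      exact ⟨d * x, by simp only; rw [mul_assoc, h]⟩
  change a * b ∈ contraction (supp x) ↔ a ∈ contraction (supp x) ∧ b ∈ contraction (supp x)
  rw [key, key, key]
  constructor
  · intro h
    constructor
    · calc x * a = x * (a * b) * a := by rw [h]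
        _ = x * (a * b * a) := mul_assoc _ _ _
        _ = x := by rw [IsLeftRegularBand.regular, h]
    · calc x * b = x * (a * b) * b := by rw [h]
        _ = x * (a * (b * b)) := by simp only [mul_assoc]
        _ = x := by rw [IsLeftRegularBand.idem, h]
  · rintro ⟨h1, h2⟩
    rw [← mul_assoc, h1, h2]

open Classical in
/-- The character of `B` with value `1` on `B_{≥ X}` and `0` elsewhere. -/
noncomputable def charMul (X : Support B) : B →ₙ* k where
  toFun b := if b ∈ contraction X then 1 else 0
  map_mul' a b := by
    by_cases ha : a ∈ contraction X <;> by_cases hb : b ∈ contraction X <;>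
      simp [mem_contraction_mul, ha, hb]

/-- The character of `kB` by which `kB` acts on `k_X`. -/
noncomputable def charX [HasUnit k B] (X : Support B) : BandAlg k B →+* k :=
  extendHom k (charMul k X) (by
    obtain ⟨x, hx⟩ := X.2
    have hmem : x ∈ contraction X := by intro y hy; rw [hx] at hy; exact hy
    exact ⟨x, by simp [charMul, hmem]⟩)

/-- The one-dimensional module `k_X`, on which `b ∈ B` acts as `1` if `Bb ⊇ X` and as `0`
otherwise; it is both a left and a right `kB`-module. -/
def SimpleMod (k : Type*) {B : Type*} [Field k] [Semigroup B] (_X : Support B) : Type _ := k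

noncomputable instance (X : Support B) : AddCommGroup (SimpleMod k X) :=
  inferInstanceAs (AddCommGroup k)

noncomputable instance (X : Support B) : One (SimpleMod k X) := inferInstanceAs (One k)

noncomputable instance [HasUnit k B] (X : Support B) : Module (BandAlg k B) (SimpleMod k X) :=
  Module.compHom k (charX k X)

noncomputable instance [HasUnit k B] (X : Support B) : Module (BandAlg k B)ᵐᵒᵖ (SimpleMod k X) :=
  Module.compHom k ((charX k X).fromOpposite fun _ _ => mul_comm _ _)

end Simple

/-! ## Projective covers, injective envelopes, socles -/

/-- A projective cover: a surjection from a finitely generated projective module whose kernel lies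
in the radical (the intersection of all maximal submodules). Over a finite-dimensional algebra,
finitely generated modules are the same as finite-dimensional ones. -/
structure IsProjectiveCover {R P M : Type*} [Ring R] [AddCommGroup P] [AddCommGroup M] [Module R P]
    [Module R M] (φ : P →ₗ[R] M) : Prop where
  finite : Module.Finite R P
  projective : Module.Projective R P
  surjective : Function.Surjective φ
  ker_le : LinearMap.ker φ ≤ Module.jacobson R P

/-- An injective envelope: an injection into a finitely generated injective module such that every
non-zero submodule meets the image. -/
structure IsInjectiveEnvelope {R M I : Type*} [Ring R] [AddCommGroup M] [AddCommGroup I]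
    [Module R M] [Module R I] (φ : M →ₗ[R] I) : Prop where
  finite : Module.Finite R I
  module_injective : Module.Injective R I
  injective : Function.Injective φ
  essential : ∀ N : Submodule R I, N ≠ ⊥ → N ⊓ LinearMap.range φ ≠ ⊥

/-- The socle: the sum of all simple submodules, i.e. the largest semisimple submodule. -/
def moduleSocle (R M : Type*) [Ring R] [AddCommGroup M] [Module R M] : Submodule R M :=
  sSup {N : Submodule R M | IsSimpleModule R N}

/-! ## The modules attached to `e ∈ B` and a right ideal `S` of `B` -/

section Modules

variable (k : Type*) {B : Type*} [Field k] [Semigroup B] [IsLeftRegularBand B]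

/-- The maps `f : eB → k` that vanish on `S`. -/
def vanishing (e : B) (S : RightIdeal B) : Submodule k (corner e → k) where
  carrier := {f | ∀ a : corner e, (a : B) ∈ S.carrier → f a = 0}
  zero_mem' := fun _ _ => rfl
  add_mem' := by intro f g hf hg a ha; simp [hf a ha, hg a ha]
  smul_mem' := by intro c f hf a ha; simp [hf a ha]

/-- Right multiplication `a ↦ ab` on `eB`. -/
def cornerMul {e : B} (a : corner e) (b : B) : corner e :=
  ⟨a * b, (principalRight e).mul_mem b a.2⟩

/-- The action `(bf)(a) = f(ab)` of `B` on the maps `eB → k` vanishing on `S`. -/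
def vanishingAct (e : B) (S : RightIdeal B) : B →ₙ* Module.End k (vanishing k e S) where
  toFun b :=
    { toFun := fun f => ⟨fun a => f.1 (cornerMul a b), fun a ha => f.2 _ (S.mul_mem b ha)⟩
      map_add' := fun _ _ => rfl
      map_smul' := fun _ _ => rfl }
  map_mul' b c := by
    ext f a
    simp [cornerMul, mul_assoc]

/-- The left `kB`-module of all maps `f : eB → k` that vanish on `S`, with `(bf)(a) = f(ab)`. -/
def InjMod (k : Type*) {B : Type*} [Field k] [Semigroup B] [IsLeftRegularBand B] (e : B)
    (S : RightIdeal B) : Type _ := vanishing k e S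

noncomputable instance (e : B) (S : RightIdeal B) : AddCommGroup (InjMod k e S) :=
  inferInstanceAs (AddCommGroup (vanishing k e S))

noncomputable instance [HasUnit k B] (e : B) (S : RightIdeal B) :
    Module (BandAlg k B) (InjMod k e S) :=
  Module.compHom (vanishing k e S) (extendHom k (A := Module.End k (vanishing k e S)) (vanishingAct k e S) ⟨e, by
    ext f a
    obtain ⟨_, b, rfl⟩ := a
    simp [vanishingAct, cornerMul, IsLeftRegularBand.regular]⟩)

/-- The basis element of `k(eB)` given by `b ∈ eB`. -/
noncomputable def cornerBasis [HasUnit k B] {e : B} (b : corner e) :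
    linSpan k (principalRight e) :=
  ⟨basisElt k (b : B), basisElt_mem k b.2⟩

/-- The natural homomorphism `k(eB)/kS → k_{Be}` of right `kB`-modules, given by `e ↦ 1` and
`b ↦ 0` for `b ∈ eB ∖ {e}`, exists and is a projective cover. -/
def NaturalMapIsProjectiveCover [HasUnit k B] (e : B) (S : RightIdeal B) : Prop :=
  ∃ ψ : (linSpan k (principalRight e) ⧸ (linSpan k S).submoduleOf (linSpan k (principalRight e)))
      →ₗ[(BandAlg k B)ᵐᵒᵖ] SimpleMod k (supp e),
    ψ (Submodule.Quotient.mk (cornerBasis k (cornerOne e))) = 1 ∧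
    (∀ b : corner e, b ≠ cornerOne e → ψ (Submodule.Quotient.mk (cornerBasis k b)) = 0) ∧
    IsProjectiveCover ψ

/-- The left module of all maps `f : eB → k` vanishing on `S` is the injective envelope of
`k_{Be}`, embedded as the multiples of the indicator function of `e`; its socle is simple,
isomorphic to `k_{Be}`, and consists of the maps vanishing on `eB ∖ {e}`. -/
def VanishingMapsAreInjectiveEnvelope [HasUnit k B] (e : B) (S : RightIdeal B) : Prop :=
  (∃ φ : SimpleMod k (supp e) →ₗ[BandAlg k B] InjMod k e S,
    (∀ c : SimpleMod k (supp e), (φ c).1 (cornerOne e) = c) ∧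
    (∀ (c : SimpleMod k (supp e)) (a : corner e), a ≠ cornerOne e → (φ c).1 a = 0) ∧
    IsInjectiveEnvelope φ) ∧
  IsSimpleModule (BandAlg k B) (moduleSocle (BandAlg k B) (InjMod k e S)) ∧
  Nonempty (moduleSocle (BandAlg k B) (InjMod k e S) ≃ₗ[BandAlg k B] SimpleMod k (supp e)) ∧
  ∀ f : InjMod k e S, f ∈ moduleSocle (BandAlg k B) (InjMod k e S) ↔
    ∀ a : corner e, a ≠ cornerOne e → f.1 a = 0

/-- The `k_X`, `X ∈ Λ(B)`, form a complete set of pairwise non-isomorphic simple left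
`kB`-modules. -/
def SimplesClassified (k : Type u) (B : Type v) [Field k] [Semigroup B]
    [IsLeftRegularBand B] [HasUnit k B] : Prop :=
  (∀ X : Support B, IsSimpleModule (BandAlg k B) (SimpleMod k X)) ∧
  (∀ X Y : Support B, Nonempty (SimpleMod k X ≃ₗ[BandAlg k B] SimpleMod k Y) → X = Y) ∧
  ∀ (M : Type (max u v)) [AddCommGroup M] [Module (BandAlg k B) M],
    IsSimpleModule (BandAlg k B) M →
      ∃ X : Support B, Nonempty (M ≃ₗ[BandAlg k B] SimpleMod k X)

end Modules

/-! ## Sign vectors, oriented matroids and COMs -/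

/-- Sign vectors, the elements of `L^E` for `L = {0, +, -}`. -/
def Covector (E : Type*) : Type _ := E → SignType

/-- The monoid structure of `L^E`: `(xy)_e = x_e` if `x_e ≠ 0`, and `(xy)_e = y_e` otherwise. -/
instance (E : Type*) : Monoid (Covector E) where
  mul x y := fun e => if x e = 0 then y e else x e
  one := fun _ => 0
  mul_assoc x y z := by
    funext e
    change (if (if x e = 0 then y e else x e) = 0 then z e else (if x e = 0 then y e else x e)) =
      (if x e = 0 then (if y e = 0 then z e else y e) else x e)
    split_ifs <;> simp_all
  one_mul x := by
    funext e
    change (if (0 : SignType) = 0 then x e else 0) = x e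
    simp
  mul_one x := by
    funext e
    change (if x e = 0 then 0 else x e) = x e
    split_ifs <;> simp_all

instance (E : Type*) : Neg (Covector E) := ⟨fun x e => -x e⟩

theorem Covector.mul_apply {E : Type*} (x y : Covector E) (e : E) :
    (x * y) e = if x e = 0 then y e else x e := rfl

theorem Covector.neg_apply {E : Type*} (x : Covector E) (e : E) : (-x) e = -x e := rfl

instance (E : Type*) : IsLeftRegularBand (Covector E) where
  idem x := by funext e; rw [Covector.mul_apply]; split_ifs <;> simp_all
  regular x y := by funext e; simp only [Covector.mul_apply]; split_ifs <;> simp_all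

/-- The separation set of two sign vectors. -/
def sep {E : Type*} (x y : Covector E) : Set E := {e | x e = -y e ∧ x e ≠ 0}

/-- Strong elimination (OM3). -/
def StrongElimination {E : Type*} (L : Set (Covector E)) : Prop :=
  ∀ x ∈ L, ∀ y ∈ L, ∀ e ∈ sep x y, ∃ z ∈ L, z e = 0 ∧ ∀ f ∉ sep x y, z f = (x * y) f

/-- An oriented matroid on `E`, given by its covectors: (OM0), (OM2) say that they form a submonoid
of `L^E`. -/
structure OrientedMatroid (E : Type*) extends Submonoid (Covector E) where
  neg_mem' : ∀ x ∈ carrier, -x ∈ carrier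
  elim' : StrongElimination carrier

/-- A COM on `E`: strong elimination and face symmetry (FS). -/
structure COM (E : Type*) where
  carrier : Set (Covector E)
  face_symm : ∀ x ∈ carrier, ∀ y ∈ carrier, x * -y ∈ carrier
  elim : StrongElimination carrier

/-- The covectors of a COM form a subsemigroup of `L^E`. -/
def COM.toSubsemigroup {E : Type*} (L : COM E) : Subsemigroup (Covector E) where
  carrier := L.carrier
  mul_mem' := by
    intro x y hx hy
    have h := L.face_symm x hx _ (L.face_symm x hx y hy)
    have h2 : x * -(x * -y) = x * y := by
      funext e
      simp only [Covector.mul_apply, Covector.neg_apply]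
      split_ifs <;> simp_all
    rwa [h2] at h

instance {M : Type*} [Monoid M] [IsLeftRegularBand M] (S : Submonoid M) : IsLeftRegularBand S where
  idem x := Subtype.ext (IsLeftRegularBand.idem (x : M))
  regular x y := Subtype.ext (IsLeftRegularBand.regular (x : M) y)

instance {M : Type*} [Semigroup M] [IsLeftRegularBand M] (S : Subsemigroup M) :
    IsLeftRegularBand S where
  idem x := Subtype.ext (IsLeftRegularBand.idem (x : M))
  regular x y := Subtype.ext (IsLeftRegularBand.regular (x : M) y)

/-- The restriction of a sign vector to the zero set `Z(x)` of a sign vector `x`. -/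
def restrictZero {E : Type*} (x y : Covector E) : Covector {e // x e = 0} := fun e => y e

/-- The projection `π : L^{E ∪ {p}} → L^E`, where `E ∪ {p}` is `Option E` and `p` is `none`. -/
def proj {E : Type*} (x : Covector (Option E)) : Covector E := fun e => x (some e)

/-- The sign vector `(x, s)` on `E ∪ {p}`. -/
def withSign {E : Type*} (x : Covector E) (s : SignType) : Covector (Option E) := fun o => o.elim s x

namespace OrientedMatroid

variable {E : Type*}

/-- A cocircuit: a maximal non-identity element, for the order `x ≤ y ↔ yx = x`. -/
def IsCocircuit (L : OrientedMatroid E) (y : Covector E) : Prop :=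
  y ∈ L.carrier ∧ y ≠ 1 ∧ ∀ z ∈ L.carrier, z ≠ 1 → z * y = y → z = y

/-- `Lt`, an oriented matroid on `E ∪ {p}`, is a single-element extension of `L` and
`σ : C* → {0, +, -}` is the corresponding map on the cocircuits of `L`: `L` is the projection
of `Lt`, `p` is not a coloop (`(0, +)` is not a covector, so that the extension does not raise the
rank), and `(y, σ(y))` is a cocircuit of `Lt` for every cocircuit `y` of `L`. -/
structure IsExtension (L : OrientedMatroid E) (Lt : OrientedMatroid (Option E))
    (σ : {y // L.IsCocircuit y} → SignType) : Prop where
  proj_eq : L.carrier = proj '' Lt.carrier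
  not_coloop : withSign 1 1 ∉ Lt.carrier
  cocircuit : ∀ y, Lt.IsCocircuit (withSign y.1 (σ y))

/-- A generic single-element extension: `σ` has no zeros. -/
structure IsGenericExtension (L : OrientedMatroid E) (Lt : OrientedMatroid (Option E))
    (σ : {y // L.IsCocircuit y} → SignType) : Prop extends IsExtension L Lt σ where
  generic : ∀ y, σ y ≠ 0

/-- The visual hemisphere `R(σ) = π(Lt⁺(p))`, where `Lt⁺(p) = {x ∈ Lt | x_p = +}`. -/
def visual {L : OrientedMatroid E} {Lt : OrientedMatroid (Option E)}
    {σ : {y // L.IsCocircuit y} → SignType} (h : L.IsExtension Lt σ) :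
    RightIdeal L.toSubmonoid where
  carrier := {a | ∃ x ∈ Lt.carrier, x none = 1 ∧ proj x = a.1}
  mul_mem := by
    rintro ⟨a, ha⟩ ⟨b, hb⟩ ⟨x, hx, hp, rfl⟩
    have hb' : b ∈ proj '' Lt.carrier := h.proj_eq ▸ hb
    obtain ⟨y, hy, rfl⟩ := hb'
    refine ⟨x * y, Lt.mul_mem hx hy, ?_, rfl⟩
    rw [Covector.mul_apply, hp]
    simp

end OrientedMatroid

/-- The preimage `τ⁻¹(R)`, a right ideal of `B`, of a right ideal `R` of `M` under an isomorphism
`τ : eB ≃ M`. -/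
def preimageRight {B M : Type*} [Semigroup B] [IsLeftRegularBand B] [Semigroup M] {e : B}
    (τ : corner e ≃* M) (R : RightIdeal M) : RightIdeal B where
  carrier := {a | ∃ h : a ∈ corner e, τ ⟨a, h⟩ ∈ R.carrier}
  mul_mem := by
    rintro a b ⟨⟨c, rfl⟩, hR⟩
    refine ⟨(principalRight e).mul_mem b ⟨c, rfl⟩, ?_⟩
    have h := R.mul_mem (τ ⟨e * b, b, rfl⟩) hR
    rw [← map_mul] at h
    convert h using 2
    apply Subtype.ext
    change e * c * b = e * c * (e * b)
    rw [← mul_assoc, IsLeftRegularBand.regular]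

/-! ## Hyperplane arrangements and right ideals of `L^E` -/

/-- The sign vector of a point with respect to the affine hyperplanes `f_i = c_i`. -/
noncomputable def arrangementSign {E : Type*} {d : ℕ}
    (f : E → Module.Dual ℝ (EuclideanSpace ℝ (Fin d))) (c : E → ℝ)
    (x : EuclideanSpace ℝ (Fin d)) : Covector E :=
  fun i => SignType.sign (f i x - c i)

/-- For `x` in a COM, the elements `y` of `xL` with `y_e = +` for some `e ∈ Z(x)`. -/
def positiveFaces {E : Type*} (L : COM E) (x : L.toSubsemigroup) : RightIdeal L.toSubsemigroup where
  carrier := {y | y ∈ corner x ∧ ∃ e, x.1 e = 0 ∧ y.1 e = 1}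
  mul_mem := by
    rintro y z ⟨hy, e, hx, hye⟩
    refine ⟨(principalRight x).mul_mem z hy, e, hx, ?_⟩
    change (y.1 * z.1) e = 1
    rw [Covector.mul_apply, hye]
    simp

/-! ## Finite left regular bands -/

section Band

variable {B : Type*} [Semigroup B] [IsLeftRegularBand B]

/-! Everything rests on a few properties of a right ideal `S` inside `eB` (`IsHemisphere`): `e` is
not in `S`, the span `kS` contains a left identity `η` for itself, and every element of `eB` other
than `e` generates the same left ideal as some element of `S`. Left multiplication by `1 - η` kills
`kS`, so it embeds `k(eB)/kS` as a direct summand of the right module `kB`; hence the quotient is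
projective. On a simple module each element of `B` acts as `1` or `0`, depending only on its support
(`exists_character_left`, `exists_character_right`). In a simple quotient of `k(eB)/kS` the elements
of `S` kill the image of `e`, so they act as `0`; by equality of supports so do all elements of `eB`
other than `e`, and the kernel of the map to `k_X` lies in the radical
(`IsHemisphere.exists_projectiveCover`). The maps on `eB` vanishing on `S` form the linear dual of
this quotient, and the same two facts yield injectivity and the socle
(`IsHemisphere.module_injective`, `IsHemisphere.eq_range_of_isSimpleModule`).

Left identities come from connectedness (`exists_left_identity`): shrinking a right ideal one
element at a time, the obstruction to improving an approximate left identity is a function that is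
constant along comparabilities in a contraction. Right identities exist for every finite left
regular band, so a connected one has a unital algebra. COMs are connected because strong elimination
joins two covectors through one that is separated from each at fewer elements (`COM.reachable`). The
visual hemisphere is the image of the covectors of the extension that are positive at `p`. These
form a COM again, which supplies `η`. Genericity supplies the condition on supports: a non-identity
covector has a cocircuit face `y`, and `y` or `-y` lies in the hemisphere
(`isHemisphere_preimage_visual`).

A generic extension always exists: order the ground set and give each cocircuit the sign of its
first non-zero entry (`LexExtension.isGenericExtension`). -/

theorem mem_contraction_supp (b c : B) : c ∈ contraction (supp b) ↔ b * c = b := by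
  constructor
  · intro h
    obtain ⟨d, hd⟩ := h ⟨b, IsLeftRegularBand.idem b⟩
    simp only at hd
    rw [← hd, mul_assoc, IsLeftRegularBand.idem]
  · rintro h _ ⟨d, rfl⟩
    exact ⟨d * b, by simp only; rw [mul_assoc, h]⟩

/-- Every nonempty right ideal of a finite left regular band has an element whose removal leaves
a right ideal. -/
theorem exists_removable [Finite B] {S : Set B} (hS : S.Nonempty) :
    ∃ b ∈ S, ∀ c ∈ S, ∀ d, c * d = b → c = b := by
  -- The set `{a | b * a = a}` is `bB`. If `c * d = b` then `bB ⊆ cB`, so maximal size forces `bB =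
  -- cB`, and then `b = c`.
  obtain ⟨b, hb, hmax⟩ := Set.exists_max_image S (fun b => Set.ncard {a | b * a = a})
    (Set.toFinite S) hS
  refine ⟨b, hb, fun c hc d hcd => ?_⟩
  have hcb : c * b = b := by rw [← hcd, ← mul_assoc, IsLeftRegularBand.idem]
  have hsub : {a | b * a = a} ⊆ {a | c * a = a} := by
    intro a (ha : b * a = a)
    change c * a = a
    rw [← ha, ← mul_assoc, hcb]
  have heq := Set.eq_of_subset_of_ncard_le hsub (hmax c hc) (Set.toFinite _)
  have hc' : c ∈ {a | b * a = a} := heq ▸ (IsLeftRegularBand.idem c : c * c = c)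
  have hbc : b * c = c := hc'
  calc c = c * b * c := by rw [mul_assoc, hbc, IsLeftRegularBand.idem]
    _ = c * b := IsLeftRegularBand.regular _ _
    _ = b := hcb

end Band

/-! ## Sign vectors -/

theorem Covector.one_apply {E : Type*} (e : E) : (1 : Covector E) e = 0 := rfl

theorem Covector.ext {E : Type*} {x y : Covector E} (h : ∀ e, x e = y e) : x = y := funext h

instance {E : Type*} [Finite E] : Finite (Covector E) := inferInstanceAs (Finite (E → SignType))

theorem Covector.mul_eq_right_iff {E : Type*} {z x : Covector E} :
    z * x = x ↔ ∀ e, z e ≠ 0 → z e = x e := by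
  constructor
  · intro h e he
    have := congrFun h e
    rwa [Covector.mul_apply, if_neg he] at this
  · intro h
    refine Covector.ext fun e => ?_
    rw [Covector.mul_apply]
    split_ifs with he
    · rfl
    · exact h e he

theorem Covector.mul_eq_left_iff {E : Type*} {x z : Covector E} :
    x * z = x ↔ ∀ e, x e = 0 → z e = 0 := by
  constructor
  · intro h e he
    have := congrFun h e
    rwa [Covector.mul_apply, if_pos he, he] at this
  · intro h
    refine Covector.ext fun e => ?_
    rw [Covector.mul_apply]
    split_ifs with he
    · rw [h e he, he]
    · rfl

theorem mem_sep {E : Type*} {x y : Covector E} {e : E} : e ∈ sep x y ↔ x e = -y e ∧ x e ≠ 0 :=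
  Iff.rfl

/-- If `z` agrees with `xy` off the separation set of `x` and `y` and vanishes at a separating
element, then it is separated from `x` at fewer elements. -/
theorem sep_left_ssubset {E : Type*} {x y z : Covector E} {e : E} (he : e ∈ sep x y)
    (hz : z e = 0) (h : ∀ f ∉ sep x y, z f = (x * y) f) : sep x z ⊂ sep x y := by
  refine ⟨fun f hf => ?_, fun h' => ?_⟩
  · by_contra hn
    have h1 := h f hn
    rw [Covector.mul_apply, if_neg hf.2] at h1
    have h2 := hf.1
    rw [h1] at h2
    have h3 := hf.2
    revert h2 h3
    cases x f <;> decide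
  · have := (h' he).1
    rw [hz] at this
    exact he.2 this

/-- Together with the previous lemma, this lets strong elimination drive inductions on the number of
separating elements. -/
theorem sep_right_ssubset {E : Type*} {x y z : Covector E} {e : E} (he : e ∈ sep x y)
    (hz : z e = 0) (h : ∀ f ∉ sep x y, z f = (x * y) f) : sep z y ⊂ sep x y := by
  refine ⟨fun f hf => ?_, fun h' => (h' he).2 hz⟩
  by_contra hn
  have h1 := h f hn
  have h2 := hf.1
  have h3 := hf.2
  rw [Covector.mul_apply] at h1
  rw [mem_sep] at hn
  rw [h1] at h2 h3
  revert h2 h3 hn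
  cases x f <;> cases y f <;> decide

theorem mul_comm_of_sep_eq_empty {E : Type*} {x y : Covector E} (h : sep x y = ∅) :
    x * y = y * x := by
  refine Covector.ext fun f => ?_
  have hf : f ∉ sep x y := by rw [h]; exact Set.notMem_empty f
  rw [mem_sep] at hf
  rw [Covector.mul_apply, Covector.mul_apply]
  revert hf
  cases x f <;> cases y f <;> decide

/-! ## Connectedness of COMs -/

section Connected

variable {E : Type*} [Finite E]

theorem comparabilityGraph_reachable {B : Type*} [Mul B] {S : Set B} {x y : S}
    (h : (x : B) * y = y) : (comparabilityGraph S).Reachable x y := by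
  by_cases hxy : x = y
  · rw [hxy]
  · exact SimpleGraph.Adj.reachable (show (comparabilityGraph S).Adj x y from ⟨hxy, Or.inr h⟩)

/-- Induction on the number of elements separating `y` and `z`. With none, `y` and `z` commute and
`yz` lies below both. Otherwise strong elimination gives an intermediate `t` with fewer separations
from each; it stays in the contraction because it vanishes wherever `y` and `z` both do. -/
theorem COM.reachable (L : COM E) (x : L.toSubsemigroup) (n : ℕ)
    (y z : contraction (supp x)) (hn : (sep y.1.1 z.1.1).ncard ≤ n) :
    (comparabilityGraph (contraction (supp x))).Reachable y z := by
  have hmem : ∀ a : L.toSubsemigroup, a ∈ contraction (supp x) ↔ ∀ e, x.1 e = 0 → a.1 e = 0 := by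
    intro a
    rw [mem_contraction_supp, ← Covector.mul_eq_left_iff, Subtype.ext_iff]
    rfl
  induction n generalizing y z with
  | zero =>
    have hsep : sep y.1.1 z.1.1 = ∅ := by
      rw [← Set.ncard_eq_zero (Set.toFinite _)]; omega
    have hcomm := mul_comm_of_sep_eq_empty hsep
    have hyz : y.1 * z.1 ∈ contraction (supp x) :=
      (mem_contraction_mul (supp x) y.1 z.1).2 ⟨y.2, z.2⟩
    have h1 : (comparabilityGraph (contraction (supp x))).Reachable y ⟨y.1 * z.1, hyz⟩ :=
      comparabilityGraph_reachable (by
        change y.1 * (y.1 * z.1) = _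
        rw [← mul_assoc, IsLeftRegularBand.idem])
    have h2 : (comparabilityGraph (contraction (supp x))).Reachable z ⟨y.1 * z.1, hyz⟩ :=
      comparabilityGraph_reachable (by
        change z.1 * (y.1 * z.1) = y.1 * z.1
        have : y.1 * z.1 = z.1 * y.1 := Subtype.ext hcomm
        rw [this, ← mul_assoc, IsLeftRegularBand.idem])
    exact h1.trans h2.symm
  | succ n ih =>
    rcases (sep y.1.1 z.1.1).eq_empty_or_nonempty with hsep | ⟨e, he⟩
    · exact ih y z (by rw [hsep, Set.ncard_empty]; omega)
    · obtain ⟨t, ht, hte, htf⟩ := L.elim _ y.1.2 _ z.1.2 e he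
      have h1 := Set.ncard_lt_ncard (sep_left_ssubset he hte htf) (Set.toFinite _)
      have h2 := Set.ncard_lt_ncard (sep_right_ssubset he hte htf) (Set.toFinite _)
      have htm : (⟨t, ht⟩ : L.toSubsemigroup) ∈ contraction (supp x) := by
        rw [hmem]
        intro f hf
        have hy := (hmem y.1).1 y.2 f hf
        have hz := (hmem z.1).1 z.2 f hf
        change t f = 0
        rw [htf f (fun h => h.2 hy), Covector.mul_apply, hy, hz]
        simp
      exact (ih y ⟨⟨t, ht⟩, htm⟩ (by change (sep y.1.1 t).ncard ≤ n; omega)).trans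
        (ih ⟨⟨t, ht⟩, htm⟩ z (by change (sep t z.1.1).ncard ≤ n; omega))

theorem COM.isConnectedBand (L : COM E) : IsConnectedBand L.toSubsemigroup := by
  intro X
  obtain ⟨x, rfl⟩ : ∃ x, X = supp x := X.2.imp fun _ h => Subtype.ext h
  have hx : x ∈ contraction (supp x) := fun _ h => h
  have : Nonempty (contraction (supp x)) := ⟨⟨x, hx⟩⟩
  exact ⟨fun y z => L.reachable x _ y z le_rfl⟩

end Connected

/-! ## Examples of COMs -/

/-- This gives the sign vector of an interior point of a segment at the hyperplanes that do not
separate its endpoints. -/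
theorem sign_eq_zero_combination {a b s t : ℝ} (hs : 0 < s) (ht : 0 < t)
    (h : ¬(SignType.sign a = -SignType.sign b ∧ SignType.sign a ≠ 0)) :
    SignType.sign (s * a + t * b) =
      if SignType.sign a = 0 then SignType.sign b else SignType.sign a := by
  rcases lt_trichotomy a 0 with ha | ha | ha <;> rcases lt_trichotomy b 0 with hb | hb | hb
  · rw [sign_neg ha, sign_neg hb, sign_neg (by nlinarith)]; rfl
  · subst hb; rw [mul_zero, add_zero, sign_neg ha, sign_neg (by nlinarith)]; rfl
  · rw [sign_neg ha, sign_pos hb] at h; exact absurd h (by decide)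
  · subst ha; rw [mul_zero, zero_add, sign_zero, sign_neg hb, sign_neg (by nlinarith)]; rfl
  · subst ha hb; simp
  · subst ha; rw [mul_zero, zero_add, sign_zero, sign_pos hb, sign_pos (by positivity)]; rfl
  · rw [sign_pos ha, sign_neg hb] at h; exact absurd h (by decide)
  · subst hb; rw [mul_zero, add_zero, sign_pos ha, sign_pos (by positivity)]; rfl
  · rw [sign_pos ha, sign_pos hb, sign_pos (by positivity)]; rfl

/-- A sufficiently small step preserves every non-zero sign and lets `b` decide where `a` vanishes;
as `E` is finite, one `ε` serves all indices. This realises the product of sign vectors by a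
perturbation. -/
theorem exists_pos_sign_add {E : Type*} [Finite E] (a b : E → ℝ) :
    ∃ ε > 0, ∀ i, SignType.sign (a i + ε * b i) =
      if SignType.sign (a i) = 0 then SignType.sign (b i) else SignType.sign (a i) := by
  have key : ∀ i, ∀ᶠ ε in nhdsWithin (0 : ℝ) (Set.Ioi 0), SignType.sign (a i + ε * b i) =
      if SignType.sign (a i) = 0 then SignType.sign (b i) else SignType.sign (a i) := by
    intro i
    have hlim : Filter.Tendsto (fun ε : ℝ => a i + ε * b i) (nhdsWithin 0 (Set.Ioi 0))
        (nhds (a i)) := by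
      have : Continuous fun ε : ℝ => a i + ε * b i := by fun_prop
      have h := this.tendsto 0
      simp only [zero_mul, add_zero] at h
      exact h.mono_left nhdsWithin_le_nhds
    rcases lt_trichotomy (a i) 0 with ha | ha | ha
    · filter_upwards [hlim.eventually (gt_mem_nhds ha)] with ε hε
      rw [sign_neg hε, sign_neg ha]; rfl
    · filter_upwards [self_mem_nhdsWithin] with ε hε
      have hε' : (0 : ℝ) < ε := hε
      rw [ha, zero_add, sign_zero, sign_mul, sign_pos hε', one_mul]; rfl
    · filter_upwards [hlim.eventually (lt_mem_nhds ha)] with ε hε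
      rw [sign_pos hε, sign_pos ha]; rfl
  obtain ⟨ε, hε⟩ := ((Filter.eventually_all.2 key).and self_mem_nhdsWithin).exists
  exact ⟨ε, hε.2, hε.1⟩

section Arrangement

variable {E : Type*} {d : ℕ} (f : E → Module.Dual ℝ (EuclideanSpace ℝ (Fin d))) (c : E → ℝ)

/-- The witness is the point where the segment from `v` to `w` crosses the hyperplane of `e`. -/
theorem strongElimination_arrangementSign : StrongElimination (Set.range (arrangementSign f c)) := by
  rintro _ ⟨v, rfl⟩ _ ⟨w, rfl⟩ e ⟨he1, he2⟩
  simp only [arrangementSign] at he1 he2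
  set a := f e v - c e with ha
  set b := f e w - c e with hb
  -- Opposite signs of `a` and `b` make the weights `|b|` and `|a|` balance to zero at `e`.
  have hab : |a| + |b| > 0 ∧ |b| * a + |a| * b = 0 ∧ 0 < |a| ∧ 0 < |b| := by
    rcases lt_trichotomy a 0 with h | h | h
    · rw [sign_neg h] at he1
      have hb' : 0 < b := sign_eq_one_iff.1 (by revert he1; cases SignType.sign b <;> decide)
      rw [abs_of_neg h, abs_of_pos hb']
      exact ⟨by linarith, by ring, by linarith, hb'⟩
    · rw [h, sign_zero] at he2; exact absurd rfl he2
    · rw [sign_pos h] at he1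
      have hb' : b < 0 := sign_eq_neg_one_iff.1 (by revert he1; cases SignType.sign b <;> decide)
      rw [abs_of_neg hb', abs_of_pos h]
      exact ⟨by linarith, by ring, h, by linarith⟩
  obtain ⟨hpos, hzero, ha0, hb0⟩ := hab
  have hcomb : ∀ i, f i ((|b| / (|a| + |b|)) • v + (|a| / (|a| + |b|)) • w) - c i =
      |b| / (|a| + |b|) * (f i v - c i) + |a| / (|a| + |b|) * (f i w - c i) := by
    intro i
    rw [map_add, map_smul, map_smul, smul_eq_mul, smul_eq_mul]
    field_simp
    ring
  refine ⟨_, ⟨(|b| / (|a| + |b|)) • v + (|a| / (|a| + |b|)) • w, rfl⟩, ?_, fun i hi => ?_⟩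
  · change SignType.sign _ = 0
    rw [hcomb e, sign_eq_zero_iff, ← ha, ← hb]
    field_simp
    linarith
  · change SignType.sign _ = _
    rw [hcomb i, Covector.mul_apply]
    exact sign_eq_zero_combination (by positivity) (by positivity) hi

/-- The covectors of an affine hyperplane arrangement form a COM. -/
theorem exists_com_arrangementSign [Finite E] :
    ∃ L : COM E, L.carrier = Set.range (arrangementSign f c) := by
  refine ⟨⟨_, ?_, strongElimination_arrangementSign f c⟩, rfl⟩
  rintro _ ⟨v, rfl⟩ _ ⟨w, rfl⟩
  -- Prolong the segment from `w` to `v` slightly beyond `v`: on a hyperplane through `v` the new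
  -- point lies on the side opposite to `w`.
  obtain ⟨ε, -, hε⟩ := exists_pos_sign_add (fun i => f i v - c i)
    (fun i => (f i v - c i) - (f i w - c i))
  refine ⟨v + ε • (v - w), Covector.ext fun i => ?_⟩
  have : f i (v + ε • (v - w)) - c i =
      (f i v - c i) + ε * ((f i v - c i) - (f i w - c i)) := by
    rw [map_add, map_smul, map_sub, smul_eq_mul]; ring
  change SignType.sign _ = _
  rw [this, hε i, Covector.mul_apply]
  change (if SignType.sign (f i v - c i) = 0 then _ else _) =
    if SignType.sign (f i v - c i) = 0 then -SignType.sign (f i w - c i) else _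
  split_ifs with h
  · rw [sign_eq_zero_iff.1 h, zero_sub, Left.sign_neg]
  · rfl

/-- The covectors of a central hyperplane arrangement form an oriented matroid. -/
theorem exists_orientedMatroid_arrangementSign [Finite E] :
    ∃ L : OrientedMatroid E, L.carrier = Set.range (arrangementSign f 0) := by
  refine ⟨⟨⟨⟨Set.range (arrangementSign f 0), ?_⟩, ?_⟩, ?_,
    strongElimination_arrangementSign f 0⟩, rfl⟩
  · rintro _ _ ⟨v, rfl⟩ ⟨w, rfl⟩
    obtain ⟨ε, -, hε⟩ := exists_pos_sign_add (fun i => f i v) (fun i => f i w)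
    refine ⟨v + ε • w, Covector.ext fun i => ?_⟩
    simpa [arrangementSign, Covector.mul_apply] using hε i
  · exact ⟨0, Covector.ext fun i => by simp [arrangementSign, Covector.one_apply]⟩
  · rintro _ ⟨v, rfl⟩
    exact ⟨-v, Covector.ext fun i => by
      simp [arrangementSign, Covector.neg_apply, Left.sign_neg]⟩

end Arrangement

/-- The covectors of an oriented matroid that are positive on `A` form a COM. -/
def OrientedMatroid.positiveCOM {E : Type*} (L : OrientedMatroid E) (A : Set E) : COM E where
  carrier := {x | x ∈ L.carrier ∧ ∀ e ∈ A, x e = 1}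
  face_symm := fun x hx y hy => ⟨L.mul_mem hx.1 (L.neg_mem' y hy.1), fun e he => by
    rw [Covector.mul_apply, hx.2 e he]; rfl⟩
  elim := by
    intro x hx y hy e he
    obtain ⟨z, hz, hze, hzf⟩ := L.elim' x hx.1 y hy.1 e he
    refine ⟨z, ⟨hz, fun f hf => ?_⟩, hze, hzf⟩
    have : f ∉ sep x y := by
      rw [mem_sep, hx.2 f hf, hy.2 f hf]; decide
    rw [hzf f this, Covector.mul_apply, hx.2 f hf]; rfl

/-! ## The oriented matroid on the zero set of a covector -/

section Contraction

variable {E : Type*} (L : COM E)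

theorem restrictZero_mul (x y z : Covector E) :
    restrictZero x (y * z) = restrictZero x y * restrictZero x z := rfl

theorem restrictZero_face_mul (x y : Covector E) : restrictZero x (x * y) = restrictZero x y :=
  Covector.ext fun e => by
    change (x * y) e = y e
    rw [Covector.mul_apply, if_pos e.2]

/-- The oriented matroid of the restrictions to `Z(x)` of the elements of `xL`. -/
def COM.localMatroid (x : L.toSubsemigroup) : OrientedMatroid {e // x.1 e = 0} where
  carrier := {y | ∃ z ∈ L.carrier, restrictZero x.1 z = y}
  mul_mem' := by
    rintro _ _ ⟨y, hy, rfl⟩ ⟨z, hz, rfl⟩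
    exact ⟨y * z, L.toSubsemigroup.mul_mem hy hz, rfl⟩
  one_mem' := ⟨x.1, x.2, Covector.ext fun e => e.2⟩
  neg_mem' := by
    rintro _ ⟨y, hy, rfl⟩
    -- A COM need not contain `-y`, but `x * -y` agrees with it on `Z(x)`.
    refine ⟨x.1 * -y, L.face_symm _ x.2 _ hy, ?_⟩
    rw [restrictZero_face_mul]
    rfl
  elim' := by
    rintro _ ⟨y, hy, rfl⟩ _ ⟨z, hz, rfl⟩ e he
    obtain ⟨t, ht, hte, htf⟩ := L.elim y hy z hz e.1 he
    exact ⟨_, ⟨t, ht, rfl⟩, hte, fun f hf => htf f.1 hf⟩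

theorem corner_apply_of_ne_zero {x : L.toSubsemigroup} (y : corner x) {e : E} (he : x.1 e ≠ 0) :
    y.1.1 e = x.1 e := by
  obtain ⟨_, z, rfl⟩ := y
  change (x.1 * z.1) e = x.1 e
  rw [Covector.mul_apply, if_neg he]

/-- Restriction to `Z(x)` is an isomorphism of `xL` onto an oriented matroid. -/
noncomputable def COM.localEquiv (x : L.toSubsemigroup) :
    corner x ≃* (L.localMatroid x).toSubmonoid :=
  MulEquiv.ofBijective
    ({ toFun := fun y => ⟨restrictZero x.1 y.1.1, y.1.1, y.1.2, rfl⟩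
       map_mul' := fun _ _ => rfl } : corner x →ₙ* (L.localMatroid x).toSubmonoid)
    ⟨by
      intro y z h
      have h' : restrictZero x.1 y.1.1 = restrictZero x.1 z.1.1 := congrArg Subtype.val h
      refine Subtype.ext (Subtype.ext (Covector.ext fun e => ?_))
      by_cases he : x.1 e = 0
      · exact congrFun h' ⟨e, he⟩
      · rw [corner_apply_of_ne_zero L y he, corner_apply_of_ne_zero L z he], by
      rintro ⟨_, y, hy, rfl⟩
      exact ⟨⟨x * ⟨y, hy⟩, ⟨y, hy⟩, rfl⟩, Subtype.ext (restrictZero_face_mul x.1 y)⟩⟩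

end Contraction

/-! ## Linear algebra in `kB` -/

section Linear

variable {k : Type*} {B : Type*} [Field k] [Semigroup B]

/-- The linear extension to `kB` of a map from `B` to a vector space. -/
noncomputable def linearExtension {V : Type*} [AddCommGroup V] [Module k V] (f : B → V) :
    BandAlg k B →ₗ[k] V where
  toFun x := Finsupp.linearCombination k f (MonoidAlgebra.coeff (R := k) (M := B) x)
  map_add' x y := map_add (Finsupp.linearCombination k f)
    (MonoidAlgebra.coeff (R := k) (M := B) x) (MonoidAlgebra.coeff (R := k) (M := B) y)
  map_smul' c x := map_smul (Finsupp.linearCombination k f) c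
    (MonoidAlgebra.coeff (R := k) (M := B) x)

@[simp]
theorem linearExtension_basisElt {V : Type*} [AddCommGroup V] [Module k V] (f : B → V) (b : B) :
    linearExtension (k := k) f (basisElt k b) = f b := by
  change Finsupp.linearCombination k f (Finsupp.single b 1) = _
  simp

theorem bandAlg_induction {P : BandAlg k B → Prop} (x : BandAlg k B)
    (basis : ∀ b, P (basisElt k b)) (zero : P 0) (add : ∀ x y, P x → P y → P (x + y))
    (smul : ∀ (c : k) x, P x → P (c • x)) : P x := by
  have hx := span_basisElt k x
  induction hx using Submodule.span_induction with
  | zero => exact zero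
  | add a b _ _ ha hb => exact add _ _ ha hb
  | smul t a _ ha => exact smul _ _ ha
  | mem b hb => obtain ⟨b, rfl⟩ := hb; exact basis b

/-- The span of a subset of `B` in `kB`. -/
noncomputable abbrev basisSpan (k : Type*) {B : Type*} [Field k] [Semigroup B] (S : Set B) :
    Submodule k (BandAlg k B) := Submodule.span k (basisElt k '' S)

theorem basisSpan_induction {S : Set B} {P : BandAlg k B → Prop} {x : BandAlg k B}
    (hx : x ∈ basisSpan k S) (basis : ∀ b ∈ S, P (basisElt k b)) (zero : P 0)
    (add : ∀ x y, P x → P y → P (x + y)) (smul : ∀ (c : k) x, P x → P (c • x)) : P x := by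
  induction hx using Submodule.span_induction with
  | zero => exact zero
  | add a b _ _ ha hb => exact add _ _ ha hb
  | smul t a _ ha => exact smul _ _ ha
  | mem b hb => obtain ⟨b, hb, rfl⟩ := hb; exact basis b hb

theorem basisElt_mem_basisSpan {S : Set B} {b : B} (hb : b ∈ S) : basisElt k b ∈ basisSpan k S :=
  Submodule.subset_span ⟨b, hb, rfl⟩

open Classical in
/-- The coefficient of `b` in an element of `kB`. -/
noncomputable def coefficient (k : Type*) {B : Type*} [Field k] [Semigroup B] (b : B) :
    BandAlg k B →ₗ[k] k :=
  linearExtension fun c => if c = b then 1 else 0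

open Classical in
theorem coefficient_basisElt (b c : B) :
    coefficient k b (basisElt k c) = if c = b then 1 else 0 :=
  linearExtension_basisElt _ _

theorem mem_basisSpan_diff {S : Set B} {b : B} {x : BandAlg k B} (hx : x ∈ basisSpan k S)
    (hb : coefficient k b x = 0) : x ∈ basisSpan k (S \ {b}) := by
  have key : x - coefficient k b x • basisElt k b ∈ basisSpan k (S \ {b}) := by
    refine basisSpan_induction
      (P := fun x => x - coefficient k b x • basisElt k b ∈ basisSpan k (S \ {b}))
      hx (fun c hc => ?_) (by simp) (fun y z hy hz => ?_) (fun t y hy => ?_)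
    · rw [coefficient_basisElt]
      split_ifs with h
      · rw [h, one_smul, sub_self]; exact zero_mem _
      · rw [zero_smul, sub_zero]; exact basisElt_mem_basisSpan ⟨hc, h⟩
    · rw [map_add, add_smul, add_sub_add_comm]
      exact add_mem hy hz
    · rw [map_smul, smul_assoc, ← smul_sub]
      exact Submodule.smul_mem _ _ hy
  rwa [hb, zero_smul, sub_zero] at key

/-- For a right ideal `S` with removable element `b`, the quotient of `kS` by the span of `S \ {b}`
is one-dimensional; `d` acts on it as `1` if `b * d = b` and as `0` otherwise. No other basis
element of `kS` can be multiplied into `b`. -/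
theorem coefficient_mul_of_removable {S : Set B} {b : B}
    (hrem : ∀ c ∈ S, ∀ d, c * d = b → c = b) {x : BandAlg k B} (hx : x ∈ basisSpan k S) (d : B) :
    coefficient k b (x * basisElt k d) =
      coefficient k b x * coefficient k b (basisElt k (b * d)) := by
  refine basisSpan_induction (P := fun x => coefficient k b (x * basisElt k d) =
      coefficient k b x * coefficient k b (basisElt k (b * d))) hx (fun c hc => ?_)
    (by rw [zero_mul, map_zero, zero_mul]) (fun y z hy hz => ?_) (fun t y hy => ?_)
  · rw [basisElt_mul]
    by_cases h : c = b
    · rw [h, coefficient_basisElt b b]; simp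
    · have h' : c * d ≠ b := fun h' => h (hrem c hc d h')
      rw [coefficient_basisElt b c, coefficient_basisElt b (c * d)]
      simp [h, h']
  · rw [add_mul, map_add, map_add, hy, hz, add_mul]
  · rw [bandAlg_smul_mul, map_smul, map_smul, hy, smul_mul_assoc]

end Linear

/-! ## The algebra of a connected left regular band is unital -/

section Unital

variable (k : Type*) {B : Type*} [Field k] [Semigroup B] [IsLeftRegularBand B] [Finite B]

/-- Peel off a removable `b`. If `ε` works on the remaining right ideal, the new identity is the one
with formal complement `(1 - b)(1 - ε)`: the factor `1 - b` handles `b`, and `c - c * b` is spanned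
by the smaller ideal for every other `c`. Connectedness plays no role here. -/
theorem exists_right_identity_on (n : ℕ) (S : Set B) (hS : ∀ a ∈ S, ∀ b, a * b ∈ S)
    (hn : S.ncard = n) :
    ∃ ε : BandAlg k B, ∀ b ∈ S, basisElt k b * ε = basisElt k b := by
  induction n generalizing S with
  | zero =>
    rw [Set.ncard_eq_zero] at hn
    exact ⟨0, by simp [hn]⟩
  | succ n ih =>
    obtain ⟨b, hb, hrem⟩ := exists_removable (S := S)
      (Set.nonempty_of_ncard_ne_zero (by omega))
    have hT : ∀ a ∈ S \ {b}, ∀ c, a * c ∈ S \ {b} := fun a ha c =>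
      ⟨hS a ha.1 c, fun h => ha.2 (hrem a ha.1 c h)⟩
    obtain ⟨ε, hε⟩ := ih (S \ {b}) hT (by rw [Set.ncard_sdiff_singleton_of_mem hb]; omega)
    refine ⟨ε + basisElt k b - basisElt k b * ε, fun c hc => ?_⟩
    rw [mul_sub, mul_add, ← mul_assoc, basisElt_mul]
    by_cases hcb : c = b
    · rw [hcb, IsLeftRegularBand.idem, add_sub_cancel_left]
    · have h1 := hε c ⟨hc, hcb⟩
      have h2 := hε (c * b) (hT c ⟨hc, hcb⟩ b)
      rw [h1, h2, add_sub_cancel_right]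

variable {k}

/-- An approximate left identity, correct modulo `kS`, is corrected modulo smaller and smaller right
ideals. At each step the error is measured by one scalar function `δ`, and connectedness makes it
removable by a multiple of `b`. -/
theorem exists_left_identity_of_span (hB : IsConnectedBand B) (n : ℕ) (S : Set B)
    (hS : ∀ a ∈ S, ∀ b, a * b ∈ S) (hn : S.ncard = n)
    (h : ∃ η : BandAlg k B, ∀ b, η * basisElt k b - basisElt k b ∈ basisSpan k S) :
    ∃ η : BandAlg k B, ∀ b, η * basisElt k b = basisElt k b := by
  induction n generalizing S with
  | zero =>
    rw [Set.ncard_eq_zero] at hn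
    obtain ⟨η, hη⟩ := h
    refine ⟨η, fun b => ?_⟩
    have := hη b
    rw [basisSpan, hn, Set.image_empty, Submodule.span_empty, Submodule.mem_bot] at this
    exact sub_eq_zero.mp this
  | succ n ih =>
    obtain ⟨b, hb, hrem⟩ := exists_removable (S := S)
      (Set.nonempty_of_ncard_ne_zero (by omega))
    have hT : ∀ a ∈ S \ {b}, ∀ c, a * c ∈ S \ {b} := fun a ha c =>
      ⟨hS a ha.1 c, fun h => ha.2 (hrem a ha.1 c h)⟩
    obtain ⟨η, hη⟩ := h
    set δ : B → k := fun c => coefficient k b (η * basisElt k c - basisElt k c) with hδ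
    have hmul : ∀ c d, δ (c * d) = δ c * coefficient k b (basisElt k (b * d)) := by
      intro c d
      rw [hδ]
      simp only
      rw [← coefficient_mul_of_removable hrem (hη c), sub_mul, mul_assoc, basisElt_mul]
    have hfix : ∀ c d, b * d = b → δ (c * d) = δ c := by
      intro c d hd
      rw [hmul, hd, coefficient_basisElt]
      simp
    -- If `y * x = x` with both in the contraction, then `δ x = δ (y * x) = δ y`, so `δ` is constant
    -- along edges and hence on the connected graph.
    have hconst : ∀ x y : contraction (supp b), δ x = δ y := by
      intro x y
      obtain ⟨p⟩ := (hB (supp b)).preconnected x y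
      induction p with
      | nil => rfl
      | cons hadj _ ih =>
        rename_i x y _ _
        refine Eq.trans ?_ ih
        obtain ⟨-, h | h⟩ := hadj
        · rw [← hfix y x ((mem_contraction_supp b _).1 x.2), h]
        · rw [← hfix x y ((mem_contraction_supp b _).1 y.2), h]
    -- Outside the contraction, `c = c * c` and `hmul` give `δ c = 0`.
    have hval : ∀ c, δ c = δ b * coefficient k b (basisElt k (b * c)) := by
      intro c
      by_cases hc : b * c = b
      · rw [hconst ⟨c, (mem_contraction_supp b c).2 hc⟩
          ⟨b, (mem_contraction_supp b b).2 (IsLeftRegularBand.idem b)⟩, hc, coefficient_basisElt]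
        simp
      · have := hmul c c
        rw [IsLeftRegularBand.idem] at this
        rw [coefficient_basisElt] at this ⊢
        simpa [hc] using this
    -- Subtracting the single multiple `δ b • b` cancels the coefficient of `b` in the error for all
    -- `c` at once.
    refine ih (S \ {b}) hT (by rw [Set.ncard_sdiff_singleton_of_mem hb]; omega)
      ⟨η - δ b • basisElt k b, fun c => ?_⟩
    have heq : (η - δ b • basisElt k b) * basisElt k c - basisElt k c =
        (η * basisElt k c - basisElt k c) - δ b • basisElt k (b * c) := by
      rw [sub_mul, bandAlg_smul_mul, basisElt_mul]; abel
    rw [heq]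
    refine mem_basisSpan_diff (sub_mem (hη c) (Submodule.smul_mem _ _
      (basisElt_mem_basisSpan (hS b hb c)))) ?_
    rw [map_sub, map_smul, smul_eq_mul, ← hval c, sub_self]

/-- The correction starts from `η = 0` and `S = B`. The result is used both for `B` and for the
positive side of an extension. -/
theorem exists_left_identity (hB : IsConnectedBand B) :
    ∃ η : BandAlg k B, ∀ b, η * basisElt k b = basisElt k b := by
  refine exists_left_identity_of_span hB _ Set.univ (fun _ _ _ => trivial) rfl ⟨0, fun b => ?_⟩
  rw [basisSpan, Set.image_univ]
  exact span_basisElt k _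

theorem hasUnit_of_connected (hB : IsConnectedBand B) : HasUnit k B := by
  obtain ⟨η, hη⟩ := exists_left_identity (k := k) hB
  obtain ⟨ε, hε⟩ := exists_right_identity_on k _ (Set.univ : Set B) (fun _ _ _ => trivial) rfl
  have h1 : ∀ a : BandAlg k B, η * a = a := fun a =>
    bandAlg_induction (P := fun a => η * a = a) a hη (mul_zero _) (fun x y hx hy => by rw [mul_add, hx, hy])
      (fun c x hx => by rw [bandAlg_mul_smul, hx])
  have h2 : ∀ a : BandAlg k B, a * ε = a := fun a =>
    bandAlg_induction (P := fun a => a * ε = a) a (fun b => hε b trivial) (zero_mul _)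
      (fun x y hx hy => by rw [add_mul, hx, hy])
      (fun c x hx => by rw [bandAlg_smul_mul, hx])
  have h3 : η = ε := by rw [← h2 η, h1]
  exact ⟨⟨η, fun a => ⟨h1 a, h3 ▸ h2 a⟩⟩⟩

end Unital

/-! ## Lexicographic extensions -/

namespace LexExtension

variable {E : Type*} [LinearOrder E]

/-- The first non-zero sign of `z` is `s`. -/
def LeadingSign (z : Covector E) (s : SignType) : Prop :=
  ∃ i, z i = s ∧ s ≠ 0 ∧ ∀ j < i, z j = 0

theorem LeadingSign.ne_one {z : Covector E} {s : SignType} (h : LeadingSign z s) : z ≠ 1 := by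
  obtain ⟨i, hi, hs, -⟩ := h
  rintro rfl
  exact hs hi.symm

theorem LeadingSign.sign_ne_zero {z : Covector E} {s : SignType} (h : LeadingSign z s) :
    s ≠ 0 := h.choose_spec.2.1

theorem LeadingSign.neg {z : Covector E} {s : SignType} (h : LeadingSign z s) :
    LeadingSign (-z) (-s) := by
  obtain ⟨i, hi, hs, hj⟩ := h
  refine ⟨i, by rw [Covector.neg_apply, hi], by revert hs; cases s <;> decide, fun j hji => ?_⟩
  rw [Covector.neg_apply, hj j hji]
  decide

theorem LeadingSign.unique {z : Covector E} {s t : SignType} (hs : LeadingSign z s)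
    (ht : LeadingSign z t) : s = t := by
  obtain ⟨i, hi, hs, hj⟩ := hs
  obtain ⟨i', hi', ht, hj'⟩ := ht
  rcases lt_trichotomy i i' with h | h | h
  · exact absurd (hi.symm.trans (hj' i h)) hs
  · rw [← hi, ← hi', h]
  · exact absurd (hi'.symm.trans (hj i' h)) ht

theorem exists_leadingSign [Finite E] {z : Covector E} (hz : z ≠ 1) : ∃ s, LeadingSign z s := by
  have hne : {i | z i ≠ 0}.Nonempty := by
    by_contra h
    rw [Set.not_nonempty_iff_eq_empty] at h
    refine hz (Covector.ext fun i => ?_)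
    by_contra hi
    exact (h ▸ hi : i ∈ (∅ : Set E))
  obtain ⟨i, hi, hmin⟩ := Set.exists_min_image _ id (Set.toFinite {i | z i ≠ 0}) hne
  refine ⟨z i, i, rfl, hi, fun j hj => ?_⟩
  by_contra h
  exact absurd (hmin j h) (not_le.2 hj)

/-- Some face of `x` in `L` has leading sign `s`. -/
def HasFace (L : OrientedMatroid E) (x : Covector E) (s : SignType) : Prop :=
  ∃ z ∈ L.carrier, z * x = x ∧ LeadingSign z s

variable {L : OrientedMatroid E}

theorem HasFace.mul_right {x : Covector E} {s : SignType} (h : HasFace L x s) (y : Covector E) :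
    HasFace L (x * y) s := by
  obtain ⟨z, hz, hzx, hs⟩ := h
  exact ⟨z, hz, by rw [← mul_assoc, hzx], hs⟩

theorem HasFace.neg {x : Covector E} {s : SignType} (h : HasFace L x s) : HasFace L (-x) (-s) := by
  obtain ⟨z, hz, hzx, hs⟩ := h
  refine ⟨-z, L.neg_mem' z hz, ?_, hs.neg⟩
  rw [Covector.mul_eq_right_iff] at hzx ⊢
  intro e he
  rw [Covector.neg_apply, Covector.neg_apply, hzx e]
  intro h0
  rw [Covector.neg_apply, h0] at he
  exact he (by decide)

theorem HasFace.ne_one {x : Covector E} {s : SignType} (h : HasFace L x s) : x ≠ 1 := by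
  obtain ⟨z, hz, hzx, hs⟩ := h
  rintro rfl
  exact hs.ne_one (by rwa [mul_one] at hzx)

theorem exists_hasFace [Finite E] {x : Covector E} (hx : x ∈ L.carrier) (h1 : x ≠ 1) :
    ∃ s, HasFace L x s :=
  (exists_leadingSign h1).imp fun _ hs => ⟨x, hx, IsLeftRegularBand.idem x, hs⟩

theorem HasFace.sign_cases {x : Covector E} {s : SignType} (h : HasFace L x s) :
    s = 1 ∨ s = -1 := by
  have := h.choose_spec.2.2.sign_ne_zero
  revert this
  cases s <;> decide

/-- The sign `s` at the new element may accompany `x` in the lexicographic extension. -/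
def Compatible (L : OrientedMatroid E) (x : Covector E) (s : SignType) : Prop :=
  x = 1 ∧ s = 0 ∨ x ≠ 1 ∧ (s ≠ 1 → HasFace L x (-1)) ∧ (s ≠ -1 → HasFace L x 1)
    ∨ s ≠ 0 ∧ HasFace L x s

/-- With the next lemma, this is the working form of `Compatible`. Geometrically, the relative
interior of a cell meets an open side of the new hyperplane as soon as one of its faces does; as the
hyperplane avoids all cocircuits, a non-zero cell meets it only by having faces on both sides. -/
theorem compatible_zero {x : Covector E} :
    Compatible L x 0 ↔ x = 1 ∨ HasFace L x 1 ∧ HasFace L x (-1) := by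
  constructor
  · rintro (⟨h, -⟩ | ⟨-, h1, h2⟩ | ⟨h, -⟩)
    · exact Or.inl h
    · exact Or.inr ⟨h2 (by decide), h1 (by decide)⟩
    · exact absurd rfl h
  · rintro (h | ⟨h1, h2⟩)
    · exact Or.inl ⟨h, rfl⟩
    · exact Or.inr (Or.inl ⟨h1.ne_one, fun _ => h2, fun _ => h1⟩)

theorem compatible_of_ne_zero {x : Covector E} {s : SignType} (hs : s ≠ 0) :
    Compatible L x s ↔ HasFace L x s := by
  constructor
  · rintro (⟨-, h⟩ | ⟨-, h1, h2⟩ | ⟨-, h⟩)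
    · exact absurd h hs
    · revert hs h1 h2
      cases s
      · intro h; exact absurd rfl h
      · intro _ h _; exact h (by decide)
      · intro _ _ h; exact h (by decide)
    · exact h
  · exact fun h => Or.inr (Or.inr ⟨hs, h⟩)

theorem Compatible.mul {x y : Covector E} {s t : SignType} (hx : Compatible L x s)
    (hy : Compatible L y t) : Compatible L (x * y) (if s = 0 then t else s) := by
  split_ifs with hs
  · subst hs
    rcases compatible_zero.1 hx with rfl | ⟨h1, h2⟩
    · rwa [one_mul]
    · by_cases ht : t = 0
      · subst ht
        exact compatible_zero.2 (Or.inr ⟨h1.mul_right y, h2.mul_right y⟩)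
      · rw [compatible_of_ne_zero ht]
        revert ht
        cases t
        · intro h; exact absurd rfl h
        · intro _; exact h2.mul_right y
        · intro _; exact h1.mul_right y
  · rw [compatible_of_ne_zero hs] at hx ⊢
    exact hx.mul_right y

theorem Compatible.neg {x : Covector E} {s : SignType} (hx : Compatible L x s) :
    Compatible L (-x) (-s) := by
  by_cases hs : s = 0
  · subst hs
    change Compatible L (-x) 0
    rw [compatible_zero] at hx ⊢
    rcases hx with rfl | ⟨h1, h2⟩
    · exact Or.inl (Covector.ext fun e => by rw [Covector.neg_apply]; rfl)
    · exact Or.inr ⟨h2.neg, h1.neg⟩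
  · have hs' : -s ≠ 0 := by revert hs; cases s <;> decide
    rw [compatible_of_ne_zero hs] at hx
    rw [compatible_of_ne_zero hs']
    exact hx.neg

theorem exists_compatible [Finite E] {x : Covector E} (hx : x ∈ L.carrier) :
    ∃ s, Compatible L x s := by
  by_cases h1 : x = 1
  · exact ⟨0, compatible_zero.2 (Or.inl h1)⟩
  · obtain ⟨s, hs⟩ := exists_hasFace hx h1
    exact ⟨s, (compatible_of_ne_zero hs.choose_spec.2.2.sign_ne_zero).2 hs⟩

/-- Elimination at the new element. -/
theorem exists_elim_new [Finite E] (n : ℕ) {x y : Covector E} (hx : x ∈ L.carrier)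
    (hy : y ∈ L.carrier) (hn : (sep x y).ncard ≤ n) {s t : SignType} (hxs : HasFace L x s)
    (hyt : HasFace L y t) (hst : s = -t) :
    ∃ z ∈ L.carrier, Compatible L z 0 ∧ ∀ f ∉ sep x y, z f = (x * y) f := by
  induction n generalizing x y with
  | zero =>
    have hsep : sep x y = ∅ := by
      rw [← Set.ncard_eq_zero (Set.toFinite _)]; omega
    -- When nothing separates `x` and `y`, the product `x * y = y * x` has the faces of both, hence
    -- faces of both leading signs.
    have h1 := hxs.mul_right y
    have h2 := hyt.mul_right x
    rw [← mul_comm_of_sep_eq_empty hsep] at h2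
    refine ⟨x * y, L.mul_mem hx hy, compatible_zero.2 (Or.inr ?_), fun _ _ => rfl⟩
    subst hst
    rcases hyt.sign_cases with rfl | rfl
    · exact ⟨h2, h1⟩
    · exact ⟨h1, h2⟩
  | succ n ih =>
    rcases (sep x y).eq_empty_or_nonempty with hsep | ⟨e, he⟩
    · exact ih hx hy (by rw [hsep, Set.ncard_empty]; omega) hxs hyt
    · obtain ⟨z, hz, hze, hzf⟩ := L.elim' _ hx _ hy e he
      have hl := sep_left_ssubset he hze hzf
      have hr := sep_right_ssubset he hze hzf
      have h1 := Set.ncard_lt_ncard hl (Set.toFinite _)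
      have h2 := Set.ncard_lt_ncard hr (Set.toFinite _)
      by_cases hz1 : z = 1
      · exact ⟨z, hz, compatible_zero.2 (Or.inl hz1), hzf⟩
      · obtain ⟨r, hr'⟩ := exists_hasFace hz hz1
        by_cases hrs : r = s
        · subst hrs
          obtain ⟨w, hw, hw0, hwf⟩ := ih hz hy (by omega) hr' hyt
          refine ⟨w, hw, hw0, fun f hf => ?_⟩
          rw [hwf f (fun h => hf (hr.1 h)), Covector.mul_apply, hzf f hf, Covector.mul_apply]
          split_ifs <;> simp_all
        · have hrt : r = t := by
            have h3 := hr'.sign_cases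
            have h4 := hyt.sign_cases
            revert hrs h3 h4
            rw [hst]
            cases r <;> cases t <;> decide
          obtain ⟨w, hw, hw0, hwf⟩ := ih hx hz (by omega) hxs (hrt ▸ hr')
          refine ⟨w, hw, hw0, fun f hf => ?_⟩
          rw [hwf f (fun h => hf (hl.1 h)), Covector.mul_apply, hzf f hf, Covector.mul_apply]
          split_ifs <;> simp_all

/-- Before the earlier of the two leading positions both `a` and `b` vanish, hence so does `c`. That
position itself does not separate them, since the leading signs are equal, so `c` has the sign `s`
there. -/
theorem leadingSign_of_elim {a b c : Covector E} {s : SignType} (ha : LeadingSign a s)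
    (hb : LeadingSign b s) (hc : ∀ f ∉ sep a b, c f = (a * b) f) : LeadingSign c s := by
  obtain ⟨i, hi, hs, hai⟩ := ha
  obtain ⟨j, hj, -, hbj⟩ := hb
  have hns : s ≠ -s := by revert hs; cases s <;> decide
  have h0 : ∀ f, f < i → f < j → c f = 0 := by
    intro f hfi hfj
    rw [hc f (fun h => h.2 (hai f hfi)), Covector.mul_apply, if_pos (hai f hfi), hbj f hfj]
  rcases lt_trichotomy i j with h | h | h
  · refine ⟨i, ?_, hs, fun f hf => h0 f hf (hf.trans h)⟩
    rw [hc i, Covector.mul_apply, hi, if_neg hs]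
    intro hsep
    have := hsep.1
    rw [hi, hbj i h] at this
    exact hs (this.trans (by decide))
  · subst h
    refine ⟨i, ?_, hs, fun f hf => h0 f hf hf⟩
    rw [hc i, Covector.mul_apply, hi, if_neg hs]
    intro hsep
    have := hsep.1
    rw [hi, hj] at this
    exact hns this
  · refine ⟨j, ?_, hs, fun f hf => h0 f (hf.trans h) hf⟩
    rw [hc j, Covector.mul_apply, if_pos (hai j h), hj]
    exact fun hsep => hsep.2 (hai j h)

/-- Elimination at an old element between covectors that both have a face with leading sign `s`. -/
theorem exists_elim_hasFace {x y : Covector E} (hx : x ∈ L.carrier) (hy : y ∈ L.carrier)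
    {e : E} (he : e ∈ sep x y) {s : SignType} (hxs : HasFace L x s) (hys : HasFace L y s) :
    ∃ z ∈ L.carrier, HasFace L z s ∧ z e = 0 ∧ ∀ f ∉ sep x y, z f = (x * y) f := by
  obtain ⟨z, hz, hze, hzf⟩ := L.elim' _ hx _ hy e he
  -- It is enough to find a `c` with leading sign `s` that vanishes at `e` and conforms to `x * y`
  -- off the separation set: `c * z` then has `c` as a face and takes its remaining entries from
  -- `z`.
  have reduce : ∀ c ∈ L.carrier, LeadingSign c s → c e = 0 →
      (∀ f ∉ sep x y, c f ≠ 0 → c f = (x * y) f) →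
      ∃ z ∈ L.carrier, HasFace L z s ∧ z e = 0 ∧ ∀ f ∉ sep x y, z f = (x * y) f := by
    intro c hc hcs hce hcf
    refine ⟨c * z, L.mul_mem hc hz, ⟨c, hc, by rw [← mul_assoc, IsLeftRegularBand.idem], hcs⟩,
      by rw [Covector.mul_apply, if_pos hce, hze], fun f hf => ?_⟩
    rw [Covector.mul_apply]
    split_ifs with h
    · exact hzf f hf
    · exact hcf f hf h
  obtain ⟨a, ha, hax, has⟩ := hxs
  obtain ⟨b, hb, hby, hbs⟩ := hys
  rw [Covector.mul_eq_right_iff] at hax hby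
  have ha' : ∀ f ∉ sep x y, a f ≠ 0 → a f = (x * y) f := by
    intro f _ h
    rw [Covector.mul_apply, ← hax f h, if_neg h]
  have hb' : ∀ f ∉ sep x y, b f ≠ 0 → b f = (x * y) f := by
    intro f hf h
    rw [Covector.mul_apply]
    have hbf := hby f h
    rw [hbf] at h ⊢
    rw [mem_sep] at hf
    revert hf h
    cases x f <;> cases y f <;> decide
  by_cases hae : a e = 0
  · exact reduce a ha has hae ha'
  by_cases hbe : b e = 0
  · exact reduce b hb hbs hbe hb'
  -- Both faces are non-zero at `e`, so they inherit the separation of `x` and `y` there and can be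
  -- eliminated against each other.
  obtain ⟨c, hc, hce, hcf⟩ := L.elim' _ ha _ hb e
    ⟨by rw [hax e hae, hby e hbe]; exact he.1, hae⟩
  refine reduce c hc (leadingSign_of_elim has hbs hcf) hce fun f hf h => ?_
  by_cases hsep : f ∈ sep a b
  · have hbf : b f ≠ 0 := by
      intro h0
      have := hsep.1
      rw [h0] at this
      exact hsep.2 (this.trans (by decide))
    exact absurd ⟨by rw [← hax f hsep.2, ← hby f hbf]; exact hsep.1,
      by rw [← hax f hsep.2]; exact hsep.2⟩ hf
  · have h' := hcf f hsep
    rw [h'] at h ⊢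
    rw [Covector.mul_apply] at h ⊢
    split_ifs at h ⊢ with h0
    · exact hb' f hf h
    · exact ha' f hf h

/-- The covectors of the lexicographic extension of `L` by all the elements of `E`, in order and
with positive signs. -/
def carrier (L : OrientedMatroid E) : Set (Covector (Option E)) :=
  {x | proj x ∈ L.carrier ∧ Compatible L (proj x) (x none)}

/-- Elimination at `p` is `exists_elim_new`. Elimination at an old element depends on the sign
required at `p`: if `p` separates, any compatible sign will do; a non-zero sign is kept by
`exists_elim_hasFace`; sign `0` needs both kinds of elimination. -/
theorem strongElimination_carrier [Finite E] : StrongElimination (carrier L) := by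
  have build : ∀ {x y : Covector (Option E)} {e} (z : Covector E) (s : SignType), z ∈ L.carrier →
      Compatible L z s → withSign z s e = 0 → (none ∉ sep x y → s = (x * y) none) →
      (∀ f ∉ sep (proj x) (proj y), z f = (proj x * proj y) f) →
      ∃ z ∈ carrier L, z e = 0 ∧ ∀ f ∉ sep x y, z f = (x * y) f := by
    intro x y e z s hz hzs he hs hf
    refine ⟨withSign z s, ⟨hz, hzs⟩, he, ?_⟩
    rintro (_ | f) hfs
    · exact hs hfs
    · exact hf f hfs
  rintro x ⟨hx, hxs⟩ y ⟨hy, hyt⟩ (_ | e) he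
  · have hx0 : x none ≠ 0 := he.2
    have hy0 : y none ≠ 0 := by
      intro h
      have := he.1
      rw [h] at this
      exact hx0 (this.trans (by decide))
    rw [compatible_of_ne_zero hx0] at hxs
    rw [compatible_of_ne_zero hy0] at hyt
    obtain ⟨z, hz, hz0, hzf⟩ := exists_elim_new _ hx hy le_rfl hxs hyt he.1
    exact build z 0 hz hz0 rfl (fun h => absurd he h) hzf
  · have he' : e ∈ sep (proj x) (proj y) := he
    have hx1 : proj x ≠ 1 := fun h => he'.2 (by rw [h]; rfl)
    have hy1 : proj y ≠ 1 := fun h => he'.2 (by rw [he'.1, h, Covector.one_apply]; decide)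
    by_cases hp : none ∈ sep x y
    · obtain ⟨z, hz, hze, hzf⟩ := L.elim' _ hx _ hy e he'
      obtain ⟨s, hs⟩ := exists_compatible hz
      exact build z s hz hs hze (fun h => absurd hp h) hzf
    · have hface : ∀ {w : Covector (Option E)}, Compatible L (proj w) (w none) → proj w ≠ 1 →
          ∀ s : SignType, s ≠ 0 → (w none = 0 ∨ w none = s) → HasFace L (proj w) s := by
        rintro w hw hw1 s hs (h | h)
        · rw [h, compatible_zero] at hw
          obtain ⟨h1, h2⟩ := hw.resolve_left hw1
          revert hs
          cases s
          · intro h; exact absurd rfl h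
          · intro _; exact h2
          · intro _; exact h1
        · rw [h, compatible_of_ne_zero hs] at hw
          exact hw
      by_cases hxy : (x * y) none = 0
      · have hx0 : x none = 0 := by
          by_contra h
          rw [Covector.mul_apply, if_neg h] at hxy
          exact h hxy
        have hy0 : y none = 0 := by
          rwa [Covector.mul_apply, if_pos hx0] at hxy
        have helim : ∀ s : SignType, s ≠ 0 → _ := fun s hs =>
          exists_elim_hasFace hx hy he' (hface hxs hx1 s hs (Or.inl hx0))
            (hface hyt hy1 s hs (Or.inl hy0))
        -- Sign `0` is wanted at `p`: eliminate `e` once keeping a positive face and once keeping a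
        -- negative one, then eliminate `p` between the results.
        obtain ⟨c, hc, hcs, hce, hcf⟩ := helim 1 (by decide)
        obtain ⟨c', hc', hcs', hce', hcf'⟩ := helim (-1) (by decide)
        obtain ⟨z, hz, hz0, hzf⟩ := exists_elim_new _ hc hc' le_rfl hcs hcs' (by decide)
        -- Off the separation set `c` and `c'` both equal `x * y`, so the last elimination preserves
        -- these entries, as well as the common zero at `e`.
        have hsep : ∀ f ∉ sep (proj x) (proj y), f ∉ sep c c' := by
          intro f hf h
          have h1 := h.1
          have h2 := h.2
          rw [hcf f hf, hcf' f hf] at h1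
          rw [hcf f hf] at h2
          revert h1 h2
          cases (proj x * proj y) f <;> decide
        refine build z 0 hz hz0 ?_ (fun _ => hxy.symm) fun f hf => ?_
        · change z e = 0
          rw [hzf e (fun h => h.2 hce), Covector.mul_apply, if_pos hce, hce']
        · rw [hzf f (hsep f hf), Covector.mul_apply, hcf f hf, hcf' f hf, ite_self]
      · set s := (x * y) none with hs
        have hcases : (x none = 0 ∨ x none = s) ∧ (y none = 0 ∨ y none = s) := by
          rw [mem_sep] at hp
          rw [hs, Covector.mul_apply]
          revert hp
          cases x none <;> cases y none <;> decide
        obtain ⟨z, hz, hzs, hze, hzf⟩ := exists_elim_hasFace hx hy he'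
          (hface hxs hx1 s hxy hcases.1) (hface hyt hy1 s hxy hcases.2)
        exact build z s hz ((compatible_of_ne_zero hxy).2 hzs) hze (fun _ => rfl) hzf

/-- The lexicographic extension of `L` by all the elements of `E`, in order and with positive
signs. -/
def matroid [Finite E] (L : OrientedMatroid E) : OrientedMatroid (Option E) where
  carrier := carrier L
  mul_mem' := fun hx hy => ⟨L.mul_mem hx.1 hy.1, hx.2.mul hy.2⟩
  one_mem' := ⟨L.one_mem, compatible_zero.2 (Or.inl rfl)⟩
  neg_mem' := fun _ hx => ⟨L.neg_mem' _ hx.1, hx.2.neg⟩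
  elim' := strongElimination_carrier

/-- The cocircuit signature of the lexicographic extension. -/
noncomputable def signature [Finite E] (L : OrientedMatroid E) (y : {y // L.IsCocircuit y}) :
    SignType := (exists_leadingSign y.2.2.1).choose

theorem leadingSign_signature [Finite E] (L : OrientedMatroid E) (y : {y // L.IsCocircuit y}) :
    LeadingSign y.1 (signature L y) := (exists_leadingSign y.2.2.1).choose_spec

theorem isGenericExtension [Finite E] (L : OrientedMatroid E) :
    L.IsGenericExtension (matroid L) (signature L) where
  proj_eq := by
    ext x
    constructor
    · intro hx
      obtain ⟨s, hs⟩ := exists_compatible hx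
      exact ⟨withSign x s, ⟨hx, hs⟩, rfl⟩
    · rintro ⟨x, hx, rfl⟩
      exact hx.1
  not_coloop := fun h => ((compatible_of_ne_zero (L := L) (x := 1) (s := 1) (by decide)).1 h.2).ne_one
    rfl
  cocircuit := by
    intro y
    have hs := leadingSign_signature L y
    set s := signature L y
    refine ⟨⟨y.2.1, (compatible_of_ne_zero hs.sign_ne_zero).2
      ⟨y.1, y.2.1, IsLeftRegularBand.idem y.1, hs⟩⟩, fun h => y.2.2.1 (congrArg proj h), ?_⟩
    rintro z ⟨hz, hzs⟩ hz1 hzy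
    have hpz : proj z * y.1 = y.1 := congrArg proj hzy
    by_cases h1 : proj z = 1
    · exfalso
      rcases hzs with ⟨-, h⟩ | ⟨h, -⟩ | ⟨-, h⟩
      · refine hz1 (Covector.ext fun f => ?_)
        rcases f with _ | f
        · exact h
        · exact congrFun h1 f
      · exact h h1
      · exact h.ne_one h1
    · have hzy' := y.2.2.2 _ hz h1 hpz
      have hzn := Covector.mul_eq_right_iff.1 hzy none
      -- A cocircuit has no non-identity face but itself, so its leading sign is the only sign
      -- compatible with it; in particular `0` is excluded.
      have hface : ∀ t, HasFace L (proj z) t → s = t := by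
        rintro t ⟨w, hw, hwz, ht⟩
        rw [hzy'] at hwz
        rw [y.2.2.2 w hw ht.ne_one hwz] at ht
        exact hs.unique ht
      refine Covector.ext fun f => ?_
      rcases f with _ | f
      · refine hzn fun h0 => ?_
        rw [h0, compatible_zero] at hzs
        obtain ⟨hp, hn⟩ := hzs.resolve_left h1
        have := (hface _ hp).symm.trans (hface _ hn)
        exact absurd this (by decide)
      · exact congrFun hzy' f
  generic := fun y => (leadingSign_signature L y).sign_ne_zero

end LexExtension

/-! ## Simple modules -/

section Acting

variable {B : Type*} [Semigroup B] [IsLeftRegularBand B] [Finite B]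

/-- Among the elements of `B` with a given property there is one of minimal support. -/
theorem exists_minimal_support {P : B → Prop} (hP : ∃ b, P b) :
    ∃ b, P b ∧ ∀ c, b * c ≠ b → ¬P (b * c) := by
  -- The set `{c | b * c = b}` is the contraction at `Bb`, which grows as the support shrinks.
  obtain ⟨b, hb, hmax⟩ := Set.exists_max_image {b | P b} (fun b => Set.ncard {c | b * c = b})
    (Set.toFinite _) hP
  refine ⟨b, hb, fun c hc hPc => hc ?_⟩
  have hsub : {d | b * d = b} ⊆ {d | b * c * d = b * c} := by
    intro d (hd : b * d = b)
    change b * c * d = b * c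
    calc b * c * d = b * d * c * d := by rw [hd]
      _ = b * (d * c * d) := by simp only [mul_assoc]
      _ = b * c := by rw [IsLeftRegularBand.regular, ← mul_assoc, hd]
  have heq := Set.eq_of_subset_of_ncard_le hsub (hmax _ hPc) (Set.toFinite _)
  have : c ∈ {d | b * d = b} := heq ▸ (by
    change b * c * c = b * c
    rw [mul_assoc, IsLeftRegularBand.idem])
  exact this

end Acting

section Scalars

variable {k : Type*} {B : Type*} [Field k] [Semigroup B] [HasUnit k B]

theorem smul_one_mul_bandAlg (t : k) (x : BandAlg k B) : (t • (1 : BandAlg k B)) * x = t • x := by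
  rw [bandAlg_smul_mul, one_mul]

theorem mul_smul_one_bandAlg (t : k) (x : BandAlg k B) : x * (t • (1 : BandAlg k B)) = t • x := by
  rw [bandAlg_mul_smul, mul_one]

noncomputable instance : Algebra k (BandAlg k B) :=
  Algebra.ofModule (bandAlg_smul_mul k) (bandAlg_mul_smul k)

theorem extendHom_basisElt {A : Type*} [Ring A] [Algebra k A] (f : B →ₙ* A) (hf : ∃ x, f x = 1)
    (b : B) : extendHom k f hf (basisElt k b) = f b := liftMagma_basisElt k f b

theorem extendHom_smul {A : Type*} [Ring A] [Algebra k A] (f : B →ₙ* A) (hf : ∃ x, f x = 1)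
    (t : k) (x : BandAlg k B) : extendHom k f hf (t • x) = t • extendHom k f hf x :=
  map_smul (MonoidAlgebra.liftMagma k f) t (show MonoidAlgebra k B from x)

theorem mem_linSpan {S : RightIdeal B} {x : BandAlg k B} :
    x ∈ linSpan k S ↔ x ∈ basisSpan k S.carrier := Iff.rfl

end Scalars

section Simple

variable {k : Type*} {B : Type*} [Field k] [Semigroup B] [IsLeftRegularBand B] [HasUnit k B]

open Classical in
theorem charX_basisElt (X : Support B) (b : B) :
    charX k X (basisElt k b) = if b ∈ contraction X then 1 else 0 :=
  extendHom_basisElt _ _ b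

theorem charX_smul (X : Support B) (t : k) (x : BandAlg k B) :
    charX k X (t • x) = t * charX k X x := extendHom_smul _ _ t x

variable [Finite B]

/-- On a simple left module, each element of `B` acts as `1` or `0`, according to whether its
support lies above a fixed support. -/
theorem exists_character_left (M : Type*) [AddCommGroup M] [Module (BandAlg k B) M]
    [hM : IsSimpleModule (BandAlg k B) M] :
    ∃ b : B, ∀ c, (b * c = b → ∀ m : M, basisElt k c • m = m) ∧
      (b * c ≠ b → ∀ m : M, basisElt k c • m = 0) := by
  have hex : ∃ b : B, ∃ m : M, basisElt k b • m ≠ 0 := by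
    by_contra! h
    have : Nontrivial M := IsSimpleModule.nontrivial (BandAlg k B) M
    obtain ⟨m, hm⟩ := exists_ne (0 : M)
    refine hm ((one_smul (BandAlg k B) m).symm.trans (bandAlg_induction
      (P := fun a : BandAlg k B => a • m = 0) 1 (fun b => h b m) (zero_smul _ _)
      (fun x y hx hy => by rw [add_smul, hx, hy, add_zero]) (fun c x hx => ?_)))
    rw [← smul_one_mul_bandAlg, mul_smul, hx, smul_zero]
  obtain ⟨b, ⟨m₀, hm₀⟩, hmin⟩ := exists_minimal_support hex
  simp only [not_exists, not_not] at hmin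
  -- By minimality `b * c` is either `b` or acts as zero, so the kernel of `b` is a submodule. It is
  -- proper, hence zero: `b` acts injectively and can be cancelled.
  let N : Submodule (BandAlg k B) M :=
    { carrier := {m | basisElt k b • m = 0}
      zero_mem' := smul_zero _
      add_mem' := fun {x y} (hx : _ = _) (hy : _ = _) => by
        change basisElt k b • (x + y) = 0
        rw [smul_add, hx, hy, add_zero]
      smul_mem' := fun a m (hm : _ = _) => by
        change basisElt k b • a • m = 0
        refine bandAlg_induction (P := fun a => basisElt k b • a • m = 0) a (fun c => ?_)
          (by rw [zero_smul, smul_zero]) (fun x y hx hy => by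
            rw [add_smul, smul_add, hx, hy, add_zero]) (fun t x hx => ?_)
        · rw [smul_smul, basisElt_mul]
          by_cases hc : b * c = b
          · rw [hc, hm]
          · exact hmin c hc m
        · rw [smul_smul, bandAlg_mul_smul, ← smul_one_mul_bandAlg, mul_smul, mul_smul, hx,
            smul_zero] }
  have hN : N = ⊥ := (eq_bot_or_eq_top N).resolve_right fun h =>
    hm₀ (show m₀ ∈ N by rw [h]; trivial)
  have hinj : ∀ m : M, basisElt k b • m = 0 → m = 0 := fun m hm => by
    have : m ∈ N := hm
    rwa [hN, Submodule.mem_bot] at this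
  refine ⟨b, fun c => ⟨fun hc m => ?_, fun hc m => hinj _ ?_⟩⟩
  · rw [← sub_eq_zero]
    apply hinj
    rw [smul_sub, smul_smul, basisElt_mul, hc, sub_self]
  · rw [smul_smul, basisElt_mul, hmin c hc]

/-- On a simple right module, each element of `B` acts as `1` or `0`, according to whether its
support lies above a fixed support. -/
theorem exists_character_right (M : Type*) [AddCommGroup M] [Module (BandAlg k B)ᵐᵒᵖ M]
    [hM : IsSimpleModule (BandAlg k B)ᵐᵒᵖ M] :
    ∃ b : B, ∀ c, (b * c = b → ∀ m : M, op (basisElt k c) • m = m) ∧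
      (b * c ≠ b → ∀ m : M, op (basisElt k c) • m = 0) := by
  have hex : ∃ b : B, ∃ m : M, op (basisElt k b) • m ≠ 0 := by
    by_contra! h
    have : Nontrivial M := IsSimpleModule.nontrivial (BandAlg k B)ᵐᵒᵖ M
    obtain ⟨m, hm⟩ := exists_ne (0 : M)
    refine hm ((one_smul (BandAlg k B)ᵐᵒᵖ m).symm.trans (bandAlg_induction
      (P := fun a : BandAlg k B => op a • m = 0) 1 (fun b => h b m)
      (by rw [op_zero, zero_smul])
      (fun x y hx hy => by rw [op_add, add_smul, hx, hy, add_zero]) (fun c x hx => ?_)))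
    rw [← mul_smul_one_bandAlg, op_mul, mul_smul, hx, smul_zero]
  obtain ⟨b, ⟨m₀, hm₀⟩, hmin⟩ := exists_minimal_support hex
  simp only [not_exists, not_not] at hmin
  -- On the right it is the fixed space of `b` that is a submodule. It contains every `m b`, hence
  -- is non-zero and equals `M`.
  let N : Submodule (BandAlg k B)ᵐᵒᵖ M :=
    { carrier := {m | op (basisElt k b) • m = m}
      zero_mem' := smul_zero _
      add_mem' := fun {x y} (hx : _ = _) (hy : _ = _) => by
        change op (basisElt k b) • (x + y) = x + y
        rw [smul_add, hx, hy]
      smul_mem' := fun a m (hm : _ = _) => by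
        change op (basisElt k b) • a • m = a • m
        rw [← op_unop a]
        refine bandAlg_induction
          (P := fun a => op (basisElt k b) • op a • m = op a • m) a.unop (fun c => ?_)
          (by rw [op_zero, zero_smul, smul_zero]) (fun x y hx hy => by
            rw [op_add, add_smul, smul_add, hx, hy]) (fun t x hx => ?_)
        · have hcm : op (basisElt k c) • m = op (basisElt k (b * c)) • m := by
            rw [← basisElt_mul, op_mul, mul_smul, hm]
          rw [hcm]
          by_cases hc : b * c = b
          · rw [hc, hm, hm]
          · rw [hmin c hc, smul_zero]
        · rw [← mul_smul_one_bandAlg, op_mul, mul_smul, smul_smul, ← op_mul,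
            smul_one_mul_bandAlg, ← mul_smul_one_bandAlg, op_mul, mul_smul, hx] }
  have hN : N = ⊤ := (eq_bot_or_eq_top N).resolve_left fun h => by
    have : op (basisElt k b) • m₀ ∈ N := by
      change op (basisElt k b) • op (basisElt k b) • m₀ = _
      rw [smul_smul, ← op_mul, basisElt_mul, IsLeftRegularBand.idem]
    rw [h, Submodule.mem_bot] at this
    exact hm₀ this
  have hfix : ∀ m : M, op (basisElt k b) • m = m := fun m => by
    have : m ∈ N := hN ▸ trivial
    exact this
  have hcm : ∀ c, ∀ m : M, op (basisElt k c) • m = op (basisElt k (b * c)) • m := fun c m => by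
    rw [← basisElt_mul, op_mul, mul_smul, hfix]
  refine ⟨b, fun c => ⟨fun hc m => ?_, fun hc m => ?_⟩⟩
  · rw [hcm, hc, hfix]
  · rw [hcm, hmin c hc]

omit [Finite B] in
theorem isSimpleModule_simpleMod (X : Support B) :
    IsSimpleModule (BandAlg k B) (SimpleMod k X) := by
  have : Nontrivial (SimpleMod k X) := inferInstanceAs (Nontrivial k)
  rw [isSimpleModule_iff_toSpanSingleton_surjective]
  refine ⟨this, fun m hm y => ⟨((show k from y) * (show k from m)⁻¹) • 1, ?_⟩⟩
  rw [LinearMap.toSpanSingleton_apply]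
  change charX k X _ * (show k from m) = y
  rw [charX_smul, map_one, mul_one, mul_assoc, inv_mul_cancel₀ hm, mul_one]

omit [Finite B] in
-- The action on `k_X` recovers the contraction at `X`, and `X` is the least support of its
-- elements.
theorem supp_eq_of_equiv {X Y : Support B}
    (h : Nonempty (SimpleMod k X ≃ₗ[BandAlg k B] SimpleMod k Y)) : X = Y := by
  obtain ⟨φ⟩ := h
  have hmem : ∀ b, b ∈ contraction X ↔ b ∈ contraction Y := by
    intro b
    have h1 := φ.map_smul (basisElt k b) (1 : SimpleMod k X)
    have hne : φ 1 ≠ 0 := fun h0 => one_ne_zero (α := k) (φ.map_eq_zero_iff.1 h0)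
    have hX : basisElt k b • (1 : SimpleMod k X) = charX k X (basisElt k b) * (1 : k) := rfl
    have hY : basisElt k b • φ 1 = charX k Y (basisElt k b) * (show k from φ 1) := rfl
    rw [hY, hX, charX_basisElt, charX_basisElt] at h1
    by_cases hx : b ∈ contraction X <;> by_cases hy : b ∈ contraction Y
    · exact iff_of_true hx hy
    · rw [if_pos hx, if_neg hy, mul_one, zero_mul] at h1
      exact absurd h1 hne
    · rw [if_neg hx, if_pos hy, one_mul, zero_mul] at h1
      exact absurd (h1.symm.trans (map_zero φ)) hne
    · exact iff_of_false hx hy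
  have hself : ∀ X : Support B, ∀ b, X = supp b → b ∈ contraction X := by
    rintro _ b rfl _ h
    exact h
  obtain ⟨x, hx⟩ : ∃ x, X = supp x := X.2.imp fun _ h => Subtype.ext h
  obtain ⟨y, hy⟩ : ∃ y, Y = supp y := Y.2.imp fun _ h => Subtype.ext h
  refine Subtype.ext (Set.Subset.antisymm ?_ ?_)
  · have := (hmem y).2 (hself Y y hy)
    rw [hy]
    exact this
  · have := (hmem x).1 (hself X x hx)
    rw [hx]
    exact this

/-- By `exists_character_left`, `kB` acts on `M` by scalars through `charX`. Thus the multiples of a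
non-zero `m` are the image of a non-zero map from `k_X`, which is bijective since both modules are
simple. -/
theorem exists_equiv_simpleMod (M : Type*) [AddCommGroup M] [Module (BandAlg k B) M]
    [IsSimpleModule (BandAlg k B) M] :
    ∃ X : Support B, Nonempty (M ≃ₗ[BandAlg k B] SimpleMod k X) := by
  obtain ⟨b, hb⟩ := exists_character_left (k := k) (B := B) M
  have hact : ∀ (a : BandAlg k B) (m : M), a • m = (charX k (supp b) a • (1 : BandAlg k B)) • m := by
    intro a m
    refine bandAlg_induction (P := fun a => a • m = (charX k (supp b) a • (1 : BandAlg k B)) • m) a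
      (fun c => ?_) (by rw [map_zero, zero_smul, zero_smul, zero_smul])
      (fun x y hx hy => by rw [map_add, add_smul, add_smul, add_smul, hx, hy])
      (fun t x hx => ?_)
    · rw [charX_basisElt, mem_contraction_supp]
      split_ifs with h
      · rw [(hb c).1 h, one_smul, one_smul]
      · rw [(hb c).2 h, zero_smul, zero_smul]
    · rw [charX_smul, ← smul_one_mul_bandAlg, mul_smul, hx, smul_smul, smul_one_mul_bandAlg,
        smul_smul]
  have : Nontrivial M := IsSimpleModule.nontrivial (BandAlg k B) M
  have := isSimpleModule_simpleMod (k := k) (supp b)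
  obtain ⟨m, hm⟩ := exists_ne (0 : M)
  let φ : SimpleMod k (supp b) →ₗ[BandAlg k B] M :=
    { toFun := fun t => ((show k from t) • (1 : BandAlg k B)) • m
      map_add' := fun s t => by
        rw [← add_smul, ← add_smul]; rfl
      map_smul' := fun a t => by
        change (((charX k (supp b) a * (show k from t)) • (1 : BandAlg k B))) • m = a • _
        rw [hact a, smul_smul, smul_one_mul_bandAlg, smul_smul] }
  have hφ : φ ≠ 0 := fun h => hm (by
    have h1 : φ (show k from 1) = 0 := by rw [h]; rfl
    change ((1 : k) • (1 : BandAlg k B)) • m = 0 at h1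
    rwa [one_smul, one_smul] at h1)
  exact ⟨supp b, ⟨(LinearEquiv.ofBijective φ (LinearMap.bijective_of_ne_zero hφ)).symm⟩⟩

theorem simplesClassified (k : Type u) (B : Type v) [Field k] [Semigroup B] [IsLeftRegularBand B]
    [HasUnit k B] [Finite B] : SimplesClassified k B :=
  ⟨isSimpleModule_simpleMod, fun _ _ => supp_eq_of_equiv, fun M _ _ _ => exists_equiv_simpleMod M⟩

end Simple

/-! ## Right ideals of `eB` with projective quotient -/

/-- The properties of the visual hemisphere of a generic extension on which the description of the
projective cover and the injective envelope rests. -/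
structure IsHemisphere (k : Type*) {B : Type*} [Field k] [Semigroup B] [IsLeftRegularBand B]
    (e : B) (S : RightIdeal B) : Prop where
  subset : ∀ {a}, a ∈ S.carrier → a ∈ corner e
  not_mem : e ∉ S.carrier
  exists_left_identity : ∃ η ∈ basisSpan k S.carrier, ∀ s ∈ S.carrier,
    η * basisElt k s = basisElt k s
  exists_same_support : ∀ b ∈ corner e, b ≠ e → ∃ s ∈ S.carrier, b * s = b ∧ s * b = s

section Corner

variable {B : Type*} [Semigroup B] [IsLeftRegularBand B]

theorem mul_of_mem_corner {e b : B} (hb : b ∈ corner e) : e * b = b := by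
  obtain ⟨c, rfl⟩ := hb
  rw [← mul_assoc, IsLeftRegularBand.idem]

theorem mul_right_of_mem_corner {e b : B} (hb : b ∈ corner e) : b * e = b := by
  obtain ⟨c, rfl⟩ := hb
  exact IsLeftRegularBand.regular e c

theorem mem_contraction_of_mem_corner {e b : B} (hb : b ∈ corner e) :
    b ∈ contraction (supp e) ↔ b = e := by
  rw [mem_contraction_supp, mul_of_mem_corner hb]

end Corner

/-! ### The projective cover of `k_X`. -/

section ProjectiveCover

variable {k : Type*} {B : Type*} [Field k] [Semigroup B] [IsLeftRegularBand B] [HasUnit k B]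

/-- The character `kB → k_X` as a homomorphism of right modules. -/
noncomputable def charLin (k : Type*) {B : Type*} [Field k] [Semigroup B] [IsLeftRegularBand B]
    [HasUnit k B] (X : Support B) : BandAlg k B →ₗ[(BandAlg k B)ᵐᵒᵖ] SimpleMod k X where
  toFun a := charX k X a
  map_add' := map_add _
  map_smul' r a := by
    change charX k X (a * r.unop) = charX k X r.unop * charX k X a
    rw [map_mul, mul_comm]

/-- Left multiplication in `kB` as an endomorphism of the right regular module. -/
noncomputable def leftMul (a : BandAlg k B) : BandAlg k B →ₗ[(BandAlg k B)ᵐᵒᵖ] BandAlg k B where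
  toFun x := a * x
  map_add' := mul_add a
  map_smul' r x := (mul_assoc a x r.unop).symm

omit [IsLeftRegularBand B] in
theorem leftMul_eq_self {T : Set B} {a : BandAlg k B}
    (h : ∀ s ∈ T, a * basisElt k s = basisElt k s) {x : BandAlg k B} (hx : x ∈ basisSpan k T) :
    a * x = x :=
  basisSpan_induction (P := fun x => a * x = x) hx h (mul_zero _)
    (fun x y hx hy => by rw [mul_add, hx, hy])
    (fun c x hx => by rw [bandAlg_mul_smul, hx])

/-- `kB` as a right module over itself is free of rank one. -/
noncomputable def opEquiv (A : Type*) [Ring A] : Aᵐᵒᵖ ≃ₗ[Aᵐᵒᵖ] A where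
  toFun := unop
  invFun := op
  map_add' _ _ := rfl
  map_smul' _ _ := rfl
  left_inv _ := rfl
  right_inv _ := rfl

theorem IsProjectiveCover.comp_equiv {R P Q M : Type*} [Ring R] [AddCommGroup P] [AddCommGroup Q]
    [AddCommGroup M] [Module R P] [Module R Q] [Module R M] {φ : P →ₗ[R] M}
    (h : IsProjectiveCover φ) (f : Q ≃ₗ[R] P) : IsProjectiveCover (φ ∘ₗ f.toLinearMap) where
  finite := have := h.finite; Module.Finite.equiv f.symm
  projective := have := h.projective; Module.Projective.of_equiv f.symm
  surjective := h.surjective.comp f.surjective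
  ker_le := by
    rw [LinearMap.ker_comp]
    exact (Submodule.comap_mono h.ker_le).trans
      (Module.comap_jacobson_of_bijective (f := f.toLinearMap) f.bijective).le

variable {e : B} {S : RightIdeal B}

theorem IsHemisphere.exists_projectiveCover [Finite B] (hS : IsHemisphere k e S) :
    NaturalMapIsProjectiveCover k e S := by
  set Q := linSpan k (principalRight e) with hQ
  set N := (linSpan k S).submoduleOf Q with hN
  have he : e ∈ corner e := (cornerOne e).2
  have hchar : ∀ b ∈ corner e, b ≠ e → charX k (supp e) (basisElt k b) = 0 := by
    intro b hb hbe
    rw [charX_basisElt, if_neg]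
    rwa [mem_contraction_of_mem_corner hb]
  have hker : N ≤ LinearMap.ker ((charLin k (supp e)).comp Q.subtype) := by
    intro x hx
    have hx' : x.1 ∈ basisSpan k S.carrier := hx
    change charX k (supp e) x.1 = 0
    refine basisSpan_induction (P := fun x => charX k (supp e) x = 0) hx' (fun b hb => ?_)
      (map_zero _) (fun x y hx hy => by rw [map_add, hx, hy, add_zero])
      (fun c x hx => by rw [charX_smul, hx, mul_zero])
    exact hchar b (hS.subset hb) fun h => hS.not_mem (h ▸ hb)
  have hleft : ∀ q ∈ Q, basisElt k e * q = q := fun q hq =>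
    leftMul_eq_self (fun s hs => by rw [basisElt_mul, mul_of_mem_corner hs]) (mem_linSpan.1 hq)
  have hemem : ∀ a : BandAlg k B, basisElt k e * a ∈ Q := fun a =>
    Q.smul_mem (op a) (basisElt_mem k he)
  let ψ := N.liftQ ((charLin k (supp e)).comp Q.subtype) hker
  let toP : BandAlg k B →ₗ[(BandAlg k B)ᵐᵒᵖ] Q ⧸ N :=
    N.mkQ.comp ((leftMul (basisElt k e)).codRestrict Q hemem)
  have htoP : ∀ q : Q, toP q.1 = Submodule.Quotient.mk q := fun q =>
    congrArg Submodule.Quotient.mk (Subtype.ext (hleft q.1 q.2))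
  have hsurj : Function.Surjective toP := by
    intro x
    obtain ⟨q, rfl⟩ := Submodule.Quotient.mk_surjective _ x
    exact ⟨q.1, htoP q⟩
  have hψe : ψ (Submodule.Quotient.mk (cornerBasis k (cornerOne e))) = (show k from 1) := by
    change charX k (supp e) (basisElt k e) = 1
    rw [charX_basisElt, if_pos ((mem_contraction_of_mem_corner he).2 rfl)]
  have : Module.Projective (BandAlg k B)ᵐᵒᵖ (BandAlg k B) :=
    Module.Projective.of_equiv (opEquiv (BandAlg k B))
  have : Module.Finite (BandAlg k B)ᵐᵒᵖ (BandAlg k B) :=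
    Module.Finite.equiv (opEquiv (BandAlg k B))
  refine ⟨ψ, hψe, fun b hb => ?_, Module.Finite.of_surjective toP hsurj, ?_, fun c => ?_,
    fun x hx => ?_⟩
  · exact hchar b.1 b.2 fun h => hb (Subtype.ext h)
  · obtain ⟨η, hη, hid⟩ := hS.exists_left_identity
    -- Left multiplication by `1 - η` kills `kS`, so it descends to the quotient. It is a section of
    -- `toP`, because `η * q` lies in `kS`.
    have hsec : N ≤ LinearMap.ker ((leftMul (1 - η)).comp Q.subtype) := by
      intro x hx
      change (1 - η) * x.1 = 0
      rw [sub_mul, one_mul, leftMul_eq_self hid (show x.1 ∈ basisSpan k S.carrier from hx),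
        sub_self]
    refine Module.Projective.of_split (N.liftQ _ hsec) toP (LinearMap.ext fun x => ?_)
    obtain ⟨q, rfl⟩ := Submodule.Quotient.mk_surjective _ x
    change toP ((1 - η) * q.1) = Submodule.Quotient.mk q
    have hmem : η * q.1 ∈ linSpan k S := (linSpan k S).smul_mem (op q.1) (mem_linSpan.2 hη)
    have hmemQ : η * q.1 ∈ Q := by
      rw [hQ, mem_linSpan]
      exact Submodule.span_mono (Set.image_mono fun _ h => hS.subset h) (mem_linSpan.1 hmem)
    have h0 : toP (η * q.1) = 0 :=
      (htoP ⟨_, hmemQ⟩).trans ((Submodule.Quotient.mk_eq_zero N (x := ⟨_, hmemQ⟩)).2 hmem)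
    rw [sub_mul, one_mul, map_sub, htoP q, h0, sub_zero]
  · refine ⟨toP ((show k from c) • 1), ?_⟩
    change charX k (supp e) (basisElt k e * ((show k from c) • 1)) = c
    rw [mul_smul_one_bandAlg, charX_smul, charX_basisElt,
      if_pos ((mem_contraction_of_mem_corner he).2 rfl), mul_one]
  · rw [Module.jacobson, Submodule.mem_sInf]
    -- For a maximal submodule `N'`, the simple quotient is generated by the image of `e`; the aim
    -- is that every other basis element of `k(eB)` maps to zero.
    intro N' hN'
    have := isSimpleModule_iff_isCoatom.2 hN'
    obtain ⟨b₀, hb₀⟩ := exists_character_right (k := k) (B := B) ((Q ⧸ N) ⧸ N')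
    let ρ := N'.mkQ.comp toP
    have hρ : ∀ a r : BandAlg k B, ρ (a * r) = op r • ρ a := fun a r => ρ.map_smul (op r) a
    have hρS : ∀ s ∈ S.carrier, ρ (basisElt k s) = 0 := by
      intro s hs
      change N'.mkQ (toP (basisElt k s)) = 0
      have := htoP ⟨basisElt k s, basisElt_mem k (hS.subset hs)⟩
      simp only at this
      rw [this, (Submodule.Quotient.mk_eq_zero N).2 (show _ ∈ N from basisElt_mem k hs), map_zero]
    have hρe : ∀ a : BandAlg k B, ρ (basisElt k e * a) = ρ a := by
      intro a
      change N'.mkQ (Submodule.Quotient.mk ⟨_, _⟩) = N'.mkQ (Submodule.Quotient.mk ⟨_, _⟩)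
      congr 3
      exact hleft _ (hemem a)
    have hρb : ∀ b ∈ corner e, b ≠ e → ρ (basisElt k b) = 0 := by
      intro b hb hbe
      obtain ⟨s, hs, hbs, hsb⟩ := hS.exists_same_support b hb hbe
      have h1 : ρ (basisElt k b) = op (basisElt k b) • ρ (basisElt k e) := by
        rw [← hρ, hρe]
      rw [h1]
      -- If `b` acts as the identity, so does `s`, which has the same support. But `s` sends the
      -- generator `ρ e` to `ρ s = 0`, so the generator vanishes.
      by_cases h : b₀ * b = b₀
      · have hbs' : b₀ * s = b₀ := by rw [← h, mul_assoc, hbs]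
        have h2 : ρ (basisElt k e) = 0 := by
          rw [← (hb₀ s).1 hbs' (ρ (basisElt k e)), ← hρ, hρe, hρS s hs]
        rw [h2, smul_zero]
      · exact (hb₀ b).2 h _
    have hall : ∀ q ∈ Q, ρ q = op (charX k (supp e) q • (1 : BandAlg k B)) • ρ (basisElt k e) := by
      intro q hq
      refine basisSpan_induction (P := fun q =>
        ρ q = op (charX k (supp e) q • (1 : BandAlg k B)) • ρ (basisElt k e)) (mem_linSpan.1 hq)
        (fun b hb => ?_) ?_ (fun x y hx hy => ?_) (fun t x hx => ?_)
      · by_cases hbe : b = e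
        · rw [hbe, charX_basisElt, if_pos ((mem_contraction_of_mem_corner he).2 rfl), one_smul,
            op_one, one_smul]
        · rw [hchar b hb hbe, hρb b hb hbe, zero_smul, op_zero, zero_smul]
      · rw [map_zero, map_zero, zero_smul, op_zero, zero_smul]
      · rw [map_add, map_add, add_smul, op_add, add_smul, hx, hy]
      · rw [charX_smul, ← mul_smul_one_bandAlg, hρ, hx, smul_smul, ← op_mul, mul_smul_one_bandAlg,
          smul_smul]
    obtain ⟨q, rfl⟩ := Submodule.Quotient.mk_surjective _ x
    have hq0 : charX k (supp e) q.1 = 0 := hx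
    have h := hall q.1 q.2
    rw [hq0, zero_smul, op_zero, zero_smul] at h
    have h' : N'.mkQ (toP q.1) = 0 := h
    rw [htoP q, Submodule.mkQ_apply, Submodule.Quotient.mk_eq_zero] at h'
    exact h'

end ProjectiveCover

/-! ## Injective envelopes -/

section InjectiveEnvelope

variable {k : Type*} {B : Type*} [Field k] [Semigroup B] [IsLeftRegularBand B] [HasUnit k B]
  {e : B} {S : RightIdeal B}

noncomputable instance : Module k (InjMod k e S) := inferInstanceAs (Module k (vanishing k e S))

omit [HasUnit k B] in
theorem InjMod.ext {f g : InjMod k e S} (h : ∀ a, f.1 a = g.1 a) : f = g :=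
  Subtype.ext (funext h)

omit [HasUnit k B] in
theorem exists_vanishingAct_eq_one : ∃ x, vanishingAct k e S x = 1 := by
  refine ⟨e, LinearMap.ext fun f => InjMod.ext fun a => ?_⟩
  change f.1 (cornerMul a e) = f.1 a
  exact congrArg f.1 (Subtype.ext (mul_right_of_mem_corner a.2))

theorem InjMod.basisElt_smul_apply (b : B) (f : InjMod k e S) (a : corner e) :
    (basisElt k b • f).1 a = f.1 (cornerMul a b) := by
  change ((extendHom k (A := Module.End k (vanishing k e S)) (vanishingAct k e S)
      exists_vanishingAct_eq_one (basisElt k b)) f).1 a = _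
  rw [extendHom_basisElt]
  rfl

instance : IsScalarTower k (BandAlg k B) (InjMod k e S) :=
  ⟨fun t x f => by
    change (extendHom k (A := Module.End k (vanishing k e S)) (vanishingAct k e S)
      exists_vanishingAct_eq_one (t • x)) f = _
    rw [extendHom_smul]
    rfl⟩

theorem InjMod.smul_smul_apply (t : k) (x : BandAlg k B) (f : InjMod k e S) (a : corner e) :
    ((t • x) • f).1 a = t * (x • f).1 a := by
  rw [smul_assoc]
  rfl

theorem InjMod.add_smul_apply (x y : BandAlg k B) (f : InjMod k e S) (a : corner e) :
    ((x + y) • f).1 a = (x • f).1 a + (y • f).1 a := by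
  rw [add_smul]
  rfl

theorem InjMod.zero_smul_apply (f : InjMod k e S) (a : corner e) :
    ((0 : BandAlg k B) • f).1 a = 0 := by
  rw [zero_smul]
  rfl

theorem cornerMul_cornerOne (a : corner e) : cornerMul (cornerOne e) a.1 = a :=
  Subtype.ext (mul_of_mem_corner a.2)

theorem InjMod.smul_apply_one_of_mem {η : BandAlg k B} (hsub : ∀ {a}, a ∈ S.carrier → a ∈ corner e)
    (hη : η ∈ basisSpan k S.carrier) (f : InjMod k e S) : (η • f).1 (cornerOne e) = 0 := by
  refine basisSpan_induction (P := fun η => (η • f).1 (cornerOne e) = 0) hη (fun s hs => ?_)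
    (zero_smul_apply f _) (fun x y hx hy => by rw [add_smul_apply, hx, hy, add_zero])
    (fun t x hx => by rw [smul_smul_apply, hx, mul_zero])
  rw [basisElt_smul_apply, cornerMul_cornerOne ⟨s, hsub hs⟩]
  exact f.2 _ hs

/-- A homomorphism into this module is determined by its composite with evaluation at `e`, since `f
a` is the value of `a • f` at `e`. So it suffices to extend a linear functional from `X` to `Y`. -/
theorem IsHemisphere.module_injective (hS : IsHemisphere k e S) :
    Module.Injective (BandAlg k B) (InjMod k e S) := by
  refine ⟨fun X Y _ _ _ _ f hf g => ?_⟩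
  obtain ⟨η, hη, hid⟩ := hS.exists_left_identity
  let _ : Module k X := Module.compHom X (algebraMap k (BandAlg k B))
  let _ : Module k Y := Module.compHom Y (algebraMap k (BandAlg k B))
  have hsmulY : ∀ (t : k) (y : Y), t • y = (t • (1 : BandAlg k B)) • y := fun t y => by
    rw [← Algebra.algebraMap_eq_smul_one]; rfl
  have hsmulX : ∀ (t : k) (x : X), t • x = (t • (1 : BandAlg k B)) • x := fun t x => by
    rw [← Algebra.algebraMap_eq_smul_one]; rfl
  let f' : X →ₗ[k] Y :=
    { toFun := f
      map_add' := f.map_add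
      map_smul' := fun t x => f.map_smul (algebraMap k (BandAlg k B) t) x }
  let g' : X →ₗ[k] k :=
    { toFun := fun x => (g x).1 (cornerOne e)
      map_add' := fun x y => by rw [g.map_add]; rfl
      map_smul' := fun t x => by
        rw [hsmulX, g.map_smul, InjMod.smul_smul_apply, one_smul]; rfl }
  obtain ⟨r, hr⟩ := LinearMap.exists_leftInverse_of_injective f' (LinearMap.ker_eq_bot.2 hf)
  set θ : Y →ₗ[k] k := g'.comp r with hθ
  have hθf : ∀ x, θ (f x) = (g x).1 (cornerOne e) := fun x =>
    congrArg g' (LinearMap.congr_fun hr x)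
  have hθsmul : ∀ (t : k) (a : BandAlg k B) (y : Y), θ ((t • a) • y) = t * θ (a • y) := by
    intro t a y
    rw [← smul_one_mul_bandAlg, mul_smul, ← hsmulY, map_smul, smul_eq_mul]
  -- The factor `1 - η` makes the maps vanish on `S`, as `(1 - η) * s = 0`. On the image of `X` it
  -- changes nothing, because `η • F` is zero at `e` for every `F` vanishing on `S`.
  let h : Y →ₗ[BandAlg k B] InjMod k e S :=
    { toFun := fun y => ⟨fun a => θ (((1 - η) * basisElt k a.1) • y), fun a ha => by
        simp only
        rw [sub_mul, one_mul, hid _ ha, sub_self, zero_smul, map_zero]⟩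
      map_add' := fun x y => InjMod.ext fun a => by
        change θ _ = θ _ + θ _
        rw [smul_add, map_add]
      map_smul' := fun c y => InjMod.ext fun a => by
        rw [RingHom.id_apply]
        change θ (((1 - η) * basisElt k a.1) • c • y) = _
        refine bandAlg_induction (P := fun c => θ (((1 - η) * basisElt k a.1) • c • y) =
          (c • (show InjMod k e S from ⟨fun a => θ (((1 - η) * basisElt k a.1) • y), _⟩)).1 a) c
          (fun b => ?_) ?_ (fun x z hx hz => ?_) (fun t x hx => ?_)
        · rw [InjMod.basisElt_smul_apply, smul_smul, mul_assoc, basisElt_mul]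
          rfl
        · rw [InjMod.zero_smul_apply, zero_smul, smul_zero, map_zero]
        · rw [InjMod.add_smul_apply, add_smul, smul_add, map_add, hx, hz]
        · rw [InjMod.smul_smul_apply, ← hx, smul_smul, bandAlg_mul_smul, hθsmul, smul_smul] }
  refine ⟨h, fun x => InjMod.ext fun a => ?_⟩
  change θ (((1 - η) * basisElt k a.1) • f x) = _
  rw [← f.map_smul, hθf, g.map_smul, mul_smul, sub_smul, one_smul]
  change (basisElt k a.1 • g x).1 (cornerOne e) - (η • basisElt k a.1 • g x).1 (cornerOne e) = _
  rw [InjMod.smul_apply_one_of_mem hS.subset hη, sub_zero, InjMod.basisElt_smul_apply,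
    cornerMul_cornerOne]

open Classical in
/-- The embedding of `k_{Be}` as the multiples of the indicator function of `e`. -/
noncomputable def indicatorMap (k : Type*) {B : Type*} [Field k] [Semigroup B]
    [IsLeftRegularBand B] [HasUnit k B] (e : B) (S : RightIdeal B) (he : e ∉ S.carrier) :
    SimpleMod k (supp e) →ₗ[BandAlg k B] InjMod k e S where
  toFun c := ⟨fun a => if a = cornerOne e then c else (0 : k), fun a ha => if_neg (by
    rintro rfl
    exact he ha)⟩
  map_add' c d := InjMod.ext fun a => by
    change (if a = cornerOne e then (show k from c) + (show k from d) else 0) =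
      (if a = cornerOne e then (show k from c) else 0) + (if a = cornerOne e then (show k from d)
        else 0)
    split_ifs <;> simp
  map_smul' r c := InjMod.ext fun a => by
    rw [RingHom.id_apply]
    change (if a = cornerOne e then charX k (supp e) r * (show k from c) else 0) = _
    refine bandAlg_induction (P := fun r => (if a = cornerOne e then
      charX k (supp e) r * (show k from c) else 0) = (r • (show InjMod k e S from
        ⟨fun a => if a = cornerOne e then c else (0 : k), _⟩)).1 a) r
      (fun b => ?_) ?_ (fun x z hx hz => ?_) (fun t x hx => ?_)
    · rw [InjMod.basisElt_smul_apply, charX_basisElt, mem_contraction_supp]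
      change _ = if cornerMul a b = cornerOne e then (show k from c) else 0
      -- The identity `e` is maximal in `eB`, so `a * b = e` is possible only for `a = e`.
      have hiff : cornerMul a b = cornerOne e ↔ a = cornerOne e ∧ e * b = e := by
        rw [Subtype.ext_iff, Subtype.ext_iff]
        change a.1 * b = e ↔ a.1 = e ∧ e * b = e
        constructor
        · intro h
          have hae : a.1 = e := by
            calc a.1 = a.1 * (a.1 * b) := by rw [h, mul_right_of_mem_corner a.2]
              _ = e := by rw [← mul_assoc, IsLeftRegularBand.idem, h]
          exact ⟨hae, by rw [← hae, h, hae]⟩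
        · rintro ⟨h1, h2⟩
          rw [h1, h2]
      by_cases h1 : a = cornerOne e
      · by_cases h2 : e * b = e
        · rw [if_pos h1, if_pos h2, if_pos (hiff.2 ⟨h1, h2⟩), one_mul]
        · rw [if_pos h1, if_neg h2, if_neg fun h => h2 (hiff.1 h).2, zero_mul]
      · rw [if_neg h1, if_neg fun h => h1 (hiff.1 h).1]
    · rw [InjMod.zero_smul_apply, map_zero, zero_mul, ite_self]
    · rw [InjMod.add_smul_apply, ← hx, ← hz, map_add]
      split_ifs <;> ring
    · rw [InjMod.smul_smul_apply, ← hx, charX_smul]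
      split_ifs <;> ring

theorem indicatorMap_apply_one (he : e ∉ S.carrier) (c : SimpleMod k (supp e)) :
    (indicatorMap k e S he c).1 (cornerOne e) = c := if_pos rfl

theorem indicatorMap_apply_of_ne (he : e ∉ S.carrier) (c : SimpleMod k (supp e)) {a : corner e}
    (ha : a ≠ cornerOne e) : (indicatorMap k e S he c).1 a = 0 := if_neg ha

theorem mem_range_indicatorMap (he : e ∉ S.carrier) (f : InjMod k e S) :
    f ∈ LinearMap.range (indicatorMap k e S he) ↔ ∀ a : corner e, a ≠ cornerOne e → f.1 a = 0 := by
  constructor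
  · rintro ⟨c, rfl⟩ a ha
    exact indicatorMap_apply_of_ne he c ha
  · intro h
    refine ⟨(show k from f.1 (cornerOne e)), InjMod.ext fun a => ?_⟩
    by_cases ha : a = cornerOne e
    · rw [ha]; exact indicatorMap_apply_one he _
    · exact (indicatorMap_apply_of_ne he _ ha).trans (h a ha).symm

theorem indicatorMap_injective (he : e ∉ S.carrier) :
    Function.Injective (indicatorMap k e S he) := fun c d h => by
  rw [← indicatorMap_apply_one he c, h]
  exact indicatorMap_apply_one he d

theorem isSimpleModule_range_indicatorMap (he : e ∉ S.carrier) :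
    IsSimpleModule (BandAlg k B) (LinearMap.range (indicatorMap k e S he)) := by
  have := isSimpleModule_simpleMod (k := k) (supp e)
  exact (LinearEquiv.ofInjective _ (indicatorMap_injective he)).symm.isSimpleModule_iff.2 this

/-- Let `f` lie in a simple submodule and let `a ≠ e`. If `a` acts as `0`, then `f a = 0`. If `a`
acts as `1`, so does some `s ∈ S` of the same support, and `f a = f e = f s = 0`. So `f` is a
multiple of the indicator function. -/
theorem IsHemisphere.eq_range_of_isSimpleModule [Finite B] (hS : IsHemisphere k e S)
    (T : Submodule (BandAlg k B) (InjMod k e S)) [hT : IsSimpleModule (BandAlg k B) T] :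
    T = LinearMap.range (indicatorMap k e S hS.not_mem) := by
  obtain ⟨b₀, hb₀⟩ := exists_character_left (k := k) (B := B) T
  have hle : T ≤ LinearMap.range (indicatorMap k e S hS.not_mem) := by
    intro f hf
    rw [mem_range_indicatorMap]
    intro a ha
    have hval : ∀ b : corner e, f.1 b = (basisElt k b.1 • f).1 (cornerOne e) := fun b => by
      rw [InjMod.basisElt_smul_apply, cornerMul_cornerOne]
    obtain ⟨s, hs, has, hsa⟩ := hS.exists_same_support a.1 a.2 fun h => ha (Subtype.ext h)
    by_cases h : b₀ * a.1 = b₀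
    · have hs' : b₀ * s = b₀ := by rw [← h, mul_assoc, has]
      have h1 : basisElt k a.1 • f = f := congrArg Subtype.val ((hb₀ _).1 h ⟨f, hf⟩)
      have h2 : basisElt k s • f = f := congrArg Subtype.val ((hb₀ _).1 hs' ⟨f, hf⟩)
      rw [hval a, h1, ← h2, ← hval ⟨s, hS.subset hs⟩]
      exact f.2 _ hs
    · have h1 : basisElt k a.1 • f = 0 := congrArg Subtype.val ((hb₀ _).2 h ⟨f, hf⟩)
      rw [hval a, h1]
      rfl
  have := isSimpleModule_range_indicatorMap (k := k) hS.not_mem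
  exact ((isSimpleModule_iff_isAtom.1 this).le_iff.1 hle).resolve_left
    (isSimpleModule_iff_isAtom.1 hT).1

theorem IsHemisphere.vanishingMaps [Finite B] (hS : IsHemisphere k e S) :
    VanishingMapsAreInjectiveEnvelope k e S := by
  have hfin : Module.Finite k (InjMod k e S) :=
    inferInstanceAs (Module.Finite k (vanishing k e S))
  have : IsArtinian k (InjMod k e S) := inferInstance
  have : IsArtinian (BandAlg k B) (InjMod k e S) := isArtinian_of_tower k inferInstance
  have hsimple := isSimpleModule_range_indicatorMap (k := k) hS.not_mem
  have hsocle : moduleSocle (BandAlg k B) (InjMod k e S) =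
      LinearMap.range (indicatorMap k e S hS.not_mem) :=
    le_antisymm (sSup_le fun T hT => by
      have : IsSimpleModule (BandAlg k B) T := hT
      exact (hS.eq_range_of_isSimpleModule T).le) (le_sSup hsimple)
  refine ⟨⟨indicatorMap k e S hS.not_mem, indicatorMap_apply_one _,
    fun c a ha => indicatorMap_apply_of_ne _ c ha,
    Module.Finite.of_restrictScalars_finite k (BandAlg k B) (InjMod k e S),
    hS.module_injective, indicatorMap_injective _, fun N hN => ?_⟩, ?_, ?_, fun f => ?_⟩
  -- By finite dimension, a non-zero submodule contains a simple one, which can only be the line of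
  -- the indicator function.
  · obtain ⟨T, hT, hTN⟩ := (eq_bot_or_exists_atom_le N).resolve_left hN
    have := isSimpleModule_iff_isAtom.2 hT
    have hTr := hS.eq_range_of_isSimpleModule T
    intro h
    exact hT.1 (le_bot_iff.1 (h ▸ le_inf hTN hTr.le))
  · rw [hsocle]; exact hsimple
  · rw [hsocle]
    exact ⟨(LinearEquiv.ofInjective _ (indicatorMap_injective hS.not_mem)).symm⟩
  · rw [hsocle, mem_range_indicatorMap]

end InjectiveEnvelope

/-! ## Visual hemispheres -/

section Visual

variable {E : Type*} [Finite E]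

/-- A non-identity face of `x` with fewest non-zero entries has no smaller non-identity face. -/
theorem OrientedMatroid.exists_cocircuit_face (L : OrientedMatroid E) {x : Covector E}
    (hx : x ∈ L.carrier) (h1 : x ≠ 1) : ∃ y, L.IsCocircuit y ∧ y * x = x := by
  obtain ⟨y, ⟨hy, hy1, hyx⟩, hmin⟩ := Set.exists_min_image
    {y | y ∈ L.carrier ∧ y ≠ 1 ∧ y * x = x} (fun y => Set.ncard {e | y e ≠ 0}) (Set.toFinite _)
    ⟨x, hx, h1, IsLeftRegularBand.idem x⟩
  refine ⟨y, ⟨hy, hy1, fun z hz hz1 hzy => ?_⟩, hyx⟩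
  have hle := hmin z ⟨hz, hz1, by rw [← hyx, ← mul_assoc, hzy]⟩
  rw [Covector.mul_eq_right_iff] at hzy
  have hsub : {e | z e ≠ 0} ⊆ {e | y e ≠ 0} := fun e he => by
    change y e ≠ 0
    rw [← hzy e he]
    exact he
  have heq := Set.eq_of_subset_of_ncard_le hsub hle (Set.toFinite _)
  refine Covector.ext fun e => ?_
  by_cases he : z e = 0
  · have : e ∉ {e | y e ≠ 0} := by rw [← heq]; exact fun h => h he
    rw [he]
    exact (not_not.1 this).symm
  · exact hzy e he

variable {k : Type*} [Field k] {B : Type*} [Semigroup B] [IsLeftRegularBand B]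
  {e : B} {L : OrientedMatroid E} {Lt : OrientedMatroid (Option E)}
  {σ : {y // L.IsCocircuit y} → SignType}

/-- The image in `B` of a covector of the extension that is positive at the new element. -/
noncomputable def hemisphereHom (h : L.IsExtension Lt σ) (τ : corner e ≃* L.toSubmonoid) :
    (Lt.positiveCOM {none}).toSubsemigroup →ₙ* B where
  toFun x := (τ.symm ⟨proj x.1, by
    change proj x.1 ∈ L.carrier
    rw [h.proj_eq]
    exact ⟨x.1, x.2.1, rfl⟩⟩).1
  map_mul' _ _ := congrArg Subtype.val (map_mul τ.symm ⟨_, _⟩ ⟨_, _⟩)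

omit [Finite E] in
theorem hemisphereHom_mem (h : L.IsExtension Lt σ) (τ : corner e ≃* L.toSubmonoid)
    (x : (Lt.positiveCOM {none}).toSubsemigroup) :
    hemisphereHom h τ x ∈ (preimageRight τ (OrientedMatroid.visual h)).carrier := by
  refine ⟨Subtype.property _, x.1, x.2.1, x.2.2 none rfl, ?_⟩
  change _ = (τ (τ.symm _)).1
  rw [MulEquiv.apply_symm_apply]

omit [Finite E] in
theorem exists_hemisphereHom_eq (h : L.IsExtension Lt σ) (τ : corner e ≃* L.toSubmonoid) {s : B}
    (hs : s ∈ (preimageRight τ (OrientedMatroid.visual h)).carrier) :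
    ∃ x, hemisphereHom h τ x = s := by
  obtain ⟨hse, x, hx, hxp, hxs⟩ := hs
  refine ⟨⟨x, hx, fun _ he => he ▸ hxp⟩, ?_⟩
  change (τ.symm ⟨proj x, _⟩).1 = s
  have : (⟨proj x, by rw [hxs]; exact Subtype.property _⟩ : L.toSubmonoid) = τ ⟨s, hse⟩ :=
    Subtype.ext hxs
  rw [this, MulEquiv.symm_apply_apply]

omit [Finite E] in
theorem map_cornerOne (τ : corner e ≃* L.toSubmonoid) : τ (cornerOne e) = 1 := by
  have h1 : cornerOne e * τ.symm 1 = τ.symm 1 := Subtype.ext (mul_of_mem_corner (Subtype.property _))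
  have h2 := congrArg τ h1
  rwa [map_mul, MulEquiv.apply_symm_apply, mul_one] at h2

/-- The left identity comes from the connected COM of covectors positive at `p`; `e` is avoided
because `p` is not a coloop; the equality of supports comes from genericity. -/
theorem isHemisphere_preimage_visual (h : L.IsGenericExtension Lt σ)
    (τ : corner e ≃* L.toSubmonoid) :
    IsHemisphere k e (preimageRight τ (OrientedMatroid.visual h.toIsExtension)) where
  subset := fun ha => ha.1
  not_mem := by
    rintro ⟨he, x, hx, hxp, hxs⟩
    refine h.not_coloop ?_
    have h1 : proj x = 1 := hxs.trans (congrArg Subtype.val (map_cornerOne τ))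
    have : withSign 1 1 = x := Covector.ext fun f => by
      rcases f with _ | f
      · exact hxp.symm
      · exact (congrFun h1 f).symm
    rwa [this]
  exists_left_identity := by
    obtain ⟨η, hη⟩ := exists_left_identity (k := k) (Lt.positiveCOM {none}).isConnectedBand
    let F : BandAlg k (Lt.positiveCOM {none}).toSubsemigroup →ₗ[k] BandAlg k B :=
      linearExtension fun x => basisElt k (hemisphereHom h.toIsExtension τ x)
    have hF : ∀ x, F (basisElt k x) = basisElt k (hemisphereHom h.toIsExtension τ x) := fun x =>
      linearExtension_basisElt _ x
    refine ⟨F η, bandAlg_induction (P := fun η => F η ∈ basisSpan k _) η (fun x => ?_) ?_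
      (fun x y hx hy => ?_) (fun t x hx => ?_), fun s hs => ?_⟩
    · rw [hF]
      exact basisElt_mem_basisSpan (hemisphereHom_mem _ τ x)
    · rw [map_zero]; exact zero_mem _
    · rw [map_add]; exact add_mem hx hy
    · rw [map_smul]; exact Submodule.smul_mem _ _ hx
    · obtain ⟨x, rfl⟩ := exists_hemisphereHom_eq h.toIsExtension τ hs
      -- `F` is multiplicative but need not preserve units, so only the left identity relation is
      -- transported.
      have hmul : ∀ η, F η * F (basisElt k x) = F (η * basisElt k x) := fun η => by
        refine bandAlg_induction (P := fun η => F η * F (basisElt k x) = F (η * basisElt k x)) η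
          (fun y => ?_) ?_ (fun y z hy hz => ?_) (fun t y hy => ?_)
        · rw [basisElt_mul, hF, hF, hF, map_mul, basisElt_mul]
        · rw [map_zero, zero_mul, zero_mul, map_zero]
        · rw [map_add, add_mul, add_mul, map_add, hy, hz]
        · rw [map_smul, bandAlg_smul_mul, bandAlg_smul_mul, map_smul, hy]
      rw [← hF, hmul, hη]
  exists_same_support := by
    intro b hb hbe
    set x : L.toSubmonoid := τ ⟨b, hb⟩ with hx
    have hx1 : x.1 ≠ 1 := by
      intro h1
      have : τ ⟨b, hb⟩ = τ (cornerOne e) := (Subtype.ext h1 : x = 1).trans (map_cornerOne τ).symm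
      exact hbe (congrArg Subtype.val (τ.injective this))
    have key : ∀ s ∈ (OrientedMatroid.visual h.toIsExtension).carrier, x * s = x → s * x = s →
        ∃ s ∈ (preimageRight τ (OrientedMatroid.visual h.toIsExtension)).carrier,
          b * s = b ∧ s * b = s := by
      intro s hs h1 h2
      refine ⟨(τ.symm s).1, ⟨Subtype.property _, ?_⟩, ?_, ?_⟩
      · change τ (τ.symm s) ∈ _
        rwa [MulEquiv.apply_symm_apply]
      · refine congrArg Subtype.val (?_ : ⟨b, hb⟩ * τ.symm s = ⟨b, hb⟩)
        apply τ.injective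
        rw [map_mul, MulEquiv.apply_symm_apply, ← hx, h1]
      · refine congrArg Subtype.val (?_ : τ.symm s * ⟨b, hb⟩ = τ.symm s)
        apply τ.injective
        rw [map_mul, MulEquiv.apply_symm_apply, ← hx, h2]
    -- If `σ y` is positive, `x = y * x` lies in the hemisphere. If it is negative, `-y * x` does,
    -- and it has the same support as `x` because `y` vanishes on `Z(x)`.
    obtain ⟨y, hy, hyx⟩ := L.exists_cocircuit_face x.2 hx1
    have hcov := (h.cocircuit ⟨y, hy⟩).1
    have hgen := h.generic ⟨y, hy⟩
    have hneg : -y ∈ L.toSubmonoid := L.neg_mem' y hy.1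
    have hxy : x.1 * -y = x.1 := by
      rw [Covector.mul_eq_right_iff] at hyx
      rw [Covector.mul_eq_left_iff]
      intro f hf
      have : y f = 0 := by
        by_contra h0
        exact h0 ((hyx f h0).trans hf)
      rw [Covector.neg_apply, this]
      decide
    rcases SignType.trichotomy (σ ⟨y, hy⟩) with hs | hs | hs
    · refine key (⟨-y, hneg⟩ * x) ((OrientedMatroid.visual h.toIsExtension).mul_mem x
        ⟨-withSign y (σ ⟨y, hy⟩), Lt.neg_mem' _ hcov, ?_, rfl⟩) ?_ ?_
      · change -(σ ⟨y, hy⟩) = 1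
        rw [hs]
        decide
      · rw [← mul_assoc, (Subtype.ext hxy : x * ⟨-y, hneg⟩ = x), IsLeftRegularBand.idem]
      · rw [mul_assoc, IsLeftRegularBand.idem]
    · exact absurd hs hgen
    · refine key x ?_ (IsLeftRegularBand.idem x) (IsLeftRegularBand.idem x)
      have hxe : (⟨y, hy.1⟩ : L.toSubmonoid) * x = x := Subtype.ext hyx
      rw [← hxe]
      exact (OrientedMatroid.visual h.toIsExtension).mul_mem x
        ⟨withSign y (σ ⟨y, hy⟩), hcov, hs, rfl⟩

end Visual

/-! ## Oriented matroids and COMs -/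

theorem RightIdeal.ext {B : Type*} [Mul B] {S T : RightIdeal B} (h : S.carrier = T.carrier) :
    S = T := by
  cases S
  cases T
  congr

/-- A monoid is the corner of its identity. -/
def cornerOneEquiv (M : Type*) [Monoid M] : corner (1 : M) ≃* M where
  toFun a := a.1
  invFun a := ⟨a, a, (one_mul a).symm⟩
  left_inv _ := rfl
  right_inv _ := rfl
  map_mul' _ _ := rfl

theorem preimageRight_cornerOneEquiv {M : Type*} [Monoid M] [IsLeftRegularBand M]
    (S : RightIdeal M) : preimageRight (cornerOneEquiv M) S = S :=
  RightIdeal.ext (Set.ext fun a => ⟨fun h => h.2, fun h => ⟨⟨a, (one_mul a).symm⟩, h⟩⟩)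

theorem linSpan_principalRight_one (k : Type*) [Field k] (M : Type*) [Monoid M] :
    linSpan k (principalRight (1 : M)) = ⊤ := by
  refine eq_top_iff.2 fun x _ => ?_
  have h : (principalRight (1 : M)).carrier = Set.univ :=
    Set.eq_univ_of_forall fun a => ⟨a, (one_mul a).symm⟩
  rw [mem_linSpan, basisSpan, h, Set.image_univ]
  exact span_basisElt k x

theorem basisElt_one (k : Type*) [Field k] (M : Type*) [Monoid M] : basisElt k (1 : M) = 1 := by
  have h : ∀ a : BandAlg k M, basisElt k (1 : M) * a = a := fun a =>
    bandAlg_induction (P := fun a => basisElt k (1 : M) * a = a) a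
      (fun b => by rw [basisElt_mul, one_mul]) (mul_zero _)
      (fun x y hx hy => by rw [mul_add, hx, hy]) (fun c x hx => by rw [bandAlg_mul_smul, hx])
  rw [← h 1, mul_one]

/-- The projective cover attached to the identity of a monoid, as a quotient of the whole
algebra. -/
theorem exists_projectiveCover_of_corner_one {k : Type*} [Field k] {M : Type*} [Monoid M]
    [IsLeftRegularBand M] {S : RightIdeal M} (h : NaturalMapIsProjectiveCover k (1 : M) S)
    {X : Support M} (hX : supp (1 : M) = X) :
    ∃ ψ : (BandAlg k M ⧸ linSpan k S) →ₗ[(BandAlg k M)ᵐᵒᵖ] SimpleMod k X,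
      ψ (Submodule.Quotient.mk 1) = 1 ∧
      (∀ b : M, b ≠ 1 → ψ (Submodule.Quotient.mk (basisElt k b)) = 0) ∧ IsProjectiveCover ψ := by
  subst hX
  obtain ⟨ψ, h1, h0, hψ⟩ := h
  let f : BandAlg k M ≃ₗ[(BandAlg k M)ᵐᵒᵖ] linSpan k (principalRight (1 : M)) :=
    (LinearEquiv.ofTop _ (linSpan_principalRight_one k M)).symm
  let F := Submodule.Quotient.equiv (linSpan k S)
    ((linSpan k S).submoduleOf (linSpan k (principalRight (1 : M)))) f (by
      ext x
      constructor
      · rintro ⟨y, hy, rfl⟩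
        exact hy
      · exact fun hx => ⟨x.1, hx, rfl⟩)
  have hF : ∀ b : corner (1 : M), F (Submodule.Quotient.mk (basisElt k b.1)) =
      Submodule.Quotient.mk (cornerBasis k b) := fun _ => rfl
  refine ⟨ψ ∘ₗ F.toLinearMap, ?_, fun b hb => ?_, hψ.comp_equiv F⟩
  · rw [← basisElt_one]
    exact (congrArg ψ (hF (cornerOne 1))).trans h1
  · exact (congrArg ψ (hF ⟨b, b, (one_mul b).symm⟩)).trans
      (h0 _ fun h => hb (congrArg Subtype.val h))

theorem supp_one (M : Type*) [Monoid M] : supp (1 : M) = topSupport M :=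
  Subtype.ext (Set.eq_univ_of_forall fun c => ⟨c, mul_one c⟩)

/-- For a COM that is a right ideal of `L^E`, the elements of `xL` that are positive somewhere on
`Z(x)` form the visual hemisphere of the lexicographic extension. -/
theorem positiveFaces_eq_preimageRight {E : Type*} [Finite E] [LinearOrder E] (L : COM E)
    (hL : ∀ x ∈ L.carrier, ∀ y : Covector E, x * y ∈ L.carrier) (x : L.toSubsemigroup) :
    positiveFaces L x = preimageRight (L.localEquiv x) (OrientedMatroid.visual
      (LexExtension.isGenericExtension (L.localMatroid x)).toIsExtension) := by
  refine RightIdeal.ext (Set.ext fun a => exists_prop.symm.trans (exists_congr fun ha => ?_))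
  have hmem := (L.localEquiv x ⟨a, ha⟩).2
  constructor
  · rintro ⟨e, hxe, hae⟩
    classical
    -- As `L` is a right ideal of `L^E`, it contains `x * w`. Its restriction is a face of that of
    -- `a` with a single non-zero entry, `+` at `e`, so its leading sign is `+` for any order on
    -- `E`.
    let w : Covector E := fun f => if f = e then 1 else 0
    refine ⟨withSign (L.localEquiv x ⟨a, ha⟩).1 1, ⟨hmem,
      (LexExtension.compatible_of_ne_zero (by decide : (1 : SignType) ≠ 0)).2
      ⟨restrictZero x.1 (x.1 * w), ⟨_, hL _ x.2 w, rfl⟩, ?_, ⟨e, hxe⟩, ?_, by decide,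
        fun f hf => ?_⟩⟩, rfl, rfl⟩
    · rw [restrictZero_face_mul]
      change restrictZero x.1 w * restrictZero x.1 a.1 = restrictZero x.1 a.1
      rw [← restrictZero_mul]
      congr 1
      rw [Covector.mul_eq_right_iff]
      intro f hf
      have hfe : f = e := by
        by_contra hfe
        exact hf (if_neg hfe)
      rw [hfe, hae]
      exact if_pos rfl
    · rw [restrictZero_face_mul]
      exact if_pos rfl
    · rw [restrictZero_face_mul]
      exact if_neg fun h => hf.ne (Subtype.ext h)
  · rintro ⟨z, ⟨-, hz⟩, hzn, hza⟩
    rw [hzn, LexExtension.compatible_of_ne_zero (by decide), hza] at hz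
    obtain ⟨y, -, hya, i, hi, -, -⟩ := hz
    refine ⟨i.1, i.2, ?_⟩
    rw [Covector.mul_eq_right_iff] at hya
    exact (hya i (by rw [hi]; decide)).symm.trans hi

theorem theoremt (k : Type u) [Field k] :
    -- Oriented matroids: `kL/kR(σ) → k_1̂` is the right projective cover.
    (∀ (E : Type v) [Finite E] (L : OrientedMatroid E) (Lt : OrientedMatroid (Option E))
      (σ : {y // L.IsCocircuit y} → SignType) (h : L.IsGenericExtension Lt σ),
      ∃ ψ : (BandAlg k L.toSubmonoid ⧸ linSpan k (OrientedMatroid.visual h.toIsExtension))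
          →ₗ[(BandAlg k L.toSubmonoid)ᵐᵒᵖ] SimpleMod k (topSupport L.toSubmonoid),
        ψ (Submodule.Quotient.mk 1) = 1 ∧
        (∀ b : L.toSubmonoid, b ≠ 1 → ψ (Submodule.Quotient.mk (basisElt k b)) = 0) ∧
        IsProjectiveCover ψ) ∧
    -- Connected left regular bands `B` with `eB` isomorphic to an oriented matroid.
    (∀ (B : Type v) [Semigroup B] [Finite B] [IsLeftRegularBand B], IsConnectedBand B →
      ∃ _ : HasUnit k B, SimplesClassified k B ∧
        ∀ (e : B) (E : Type w) [Finite E] (L : OrientedMatroid E)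
          (Lt : OrientedMatroid (Option E)) (σ : {y // L.IsCocircuit y} → SignType)
          (h : L.IsGenericExtension Lt σ) (τ : corner e ≃* L.toSubmonoid),
          NaturalMapIsProjectiveCover k e
            (preimageRight τ (OrientedMatroid.visual h.toIsExtension)) ∧
          VanishingMapsAreInjectiveEnvelope k e
            (preimageRight τ (OrientedMatroid.visual h.toIsExtension))) ∧
    -- COMs: the injective envelopes of all simple modules are obtained.
    (∀ (E : Type v) [Finite E] (L : COM E), IsConnectedBand L.toSubsemigroup ∧
      ∃ _ : HasUnit k L.toSubsemigroup, SimplesClassified k L.toSubsemigroup ∧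
        (∀ x : L.toSubsemigroup, ∃ (M : OrientedMatroid {e // x.1 e = 0})
          (τ : corner x ≃* M.toSubmonoid),
          (∀ y : corner x, (τ y).1 = restrictZero x.1 y.1.1) ∧
          (∃ (Mt : OrientedMatroid (Option {e // x.1 e = 0}))
            (σ : {y // M.IsCocircuit y} → SignType), M.IsGenericExtension Mt σ) ∧
          ∀ (Mt : OrientedMatroid (Option {e // x.1 e = 0}))
            (σ : {y // M.IsCocircuit y} → SignType) (h : M.IsGenericExtension Mt σ),
            NaturalMapIsProjectiveCover k x
              (preimageRight τ (OrientedMatroid.visual h.toIsExtension)) ∧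
            VanishingMapsAreInjectiveEnvelope k x
              (preimageRight τ (OrientedMatroid.visual h.toIsExtension))) ∧
        -- COMs that are right ideals in `L^E` (e.g. those of CAT(0) cube complexes).
        ((∀ x ∈ L.carrier, ∀ y : Covector E, x * y ∈ L.carrier) →
          ∀ x : L.toSubsemigroup,
            NaturalMapIsProjectiveCover k x (positiveFaces L x) ∧
            VanishingMapsAreInjectiveEnvelope k x (positiveFaces L x))) ∧
    -- Hyperplane arrangements, oriented matroids, affine oriented matroids and T-convex sets of
    -- topes give COMs.
    (∀ (E : Type v) [Finite E] (d : ℕ) (f : E → Module.Dual ℝ (EuclideanSpace ℝ (Fin d))),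
      (∃ L : OrientedMatroid E, L.carrier = Set.range (arrangementSign f 0)) ∧
      ∀ c : E → ℝ, ∃ L : COM E, L.carrier = Set.range (arrangementSign f c)) ∧
    (∀ (E : Type v) [Finite E] (L : OrientedMatroid E) (A : Set E),
      ∃ M : COM E, M.carrier = {x | x ∈ L.carrier ∧ ∀ e ∈ A, x e = 1}) := by

  refine ⟨fun E _ L Lt σ h => ?_, fun B _ _ _ hB => ?_, fun E _ L => ?_, fun E _ d f =>
    ⟨exists_orientedMatroid_arrangementSign f, fun c => exists_com_arrangementSign f c⟩,
    fun E _ L A => ⟨L.positiveCOM A, rfl⟩⟩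
  · have : Finite L.toSubmonoid := Subtype.finite
    have hS := isHemisphere_preimage_visual (k := k) h (cornerOneEquiv L.toSubmonoid)
    rw [preimageRight_cornerOneEquiv] at hS
    exact exists_projectiveCover_of_corner_one hS.exists_projectiveCover (supp_one _)
  · have hU : HasUnit k B := hasUnit_of_connected hB
    refine ⟨hU, simplesClassified k B, fun e E _ L Lt σ h τ => ?_⟩
    have hS := isHemisphere_preimage_visual (k := k) h τ
    exact ⟨hS.exists_projectiveCover, hS.vanishingMaps⟩
  · have : Finite L.toSubsemigroup := Subtype.finite
    have hU : HasUnit k L.toSubsemigroup := hasUnit_of_connected L.isConnectedBand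
    -- The order is arbitrary; it only serves to define the lexicographic extensions.
    let _ : LinearOrder E := LinearOrder.lift' (Finite.equivFin E) (Equiv.injective _)
    refine ⟨L.isConnectedBand, hU, simplesClassified k _, fun x => ⟨L.localMatroid x,
      L.localEquiv x, fun y => rfl,
      ⟨_, _, LexExtension.isGenericExtension (L.localMatroid x)⟩, fun Mt σ h => ?_⟩,
      fun hL x => ?_⟩
    · have hS := isHemisphere_preimage_visual (k := k) h (L.localEquiv x)
      exact ⟨hS.exists_projectiveCover, hS.vanishingMaps⟩
    · rw [positiveFaces_eq_preimageRight L hL x]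
      have hS := isHemisphere_preimage_visual (k := k)
        (LexExtension.isGenericExtension (L.localMatroid x)) (L.localEquiv x)
      exact ⟨hS.exists_projectiveCover, hS.vanishingMaps⟩
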